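/- A \emph{trapezoid model} $\tau$ with $n$ trapezoids consists of two parallel lines and, for each label $i\in\{0,\dots,n-1\}$, a (possibly degenerate) trapezoid given by four integers $x_1\le x_2$ and $y_1\le y_2$ in $[1,2n]$: it is the region between the two lines cut out by the interval $[x_1,x_2]$ on the first line and the interval $[y_1,y_2]$ on the second line. The trapezoid graph $G(\tau)$ has the $n$ labels as vertices, two distinct labels being adjacent if and only if their (closed) trapezoids intersect; let $m$ be the number of its edges. An \emph{induced matching} of a graph is a set $M$ of edges such that, for any two distinct edges of $M$, no endpoint of the one is adjacent to an endpoint of the other. \textbf{Theorem.} Given a trapezoid model $\tau$ with $n$ trapezoids, an induced matching of $G(\tau)$ of maximum cardinality can be found in $\mathcal{O}(m+n)$ time on a unit-cost random access machine with words of $\mathcal{O}(\log n)$ bits. That is, there are a single program $P$ and a constant $C$ such that for every $n\ge 0$ and every trapezoid model $\tau$ with $n$ trapezoids, the program $P$, started with $n$ and the coordinates of the trapezoids of $\tau$ in its memory (all other cells being $0$), halts after at most $C\,(n+m+1)$ steps with a list, without repetition, of the edges of a maximum induced matching of $G(\tau)$ in its memory, and no constant or arithmetic result in the run exceeds $C\,(n+1)^C$.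 Here the elementary steps are: setting a register to a constant, copying a register, addition, truncated subtraction, multiplication, division with remainder, reading or writing a memory cell whose address is in a register, and comparing two registers in a conditional or a loop. -/

import Mathlib

/-! ## Induced matchings -/

/-- A set `M` of edges of `G` is an induced matching if no endpoint of one edge of `M` is adjacent
in `G` to an endpoint of another edge of `M`. (Two edges `uv`, `uw` sharing a vertex are excluded
as well, since then the endpoint `u` of the one is adjacent to the endpoint `w` of the other.) -/
def SimpleGraph.IsInducedMatching {V : Type*} (G : SimpleGraph V) (M : Finset (Sym2 V)) : Prop :=
  (∀ e ∈ M, e ∈ G.edgeSet) ∧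
    ∀ e₁ ∈ M, ∀ e₂ ∈ M, e₁ ≠ e₂ → ∀ u ∈ e₁, ∀ v ∈ e₂, ¬ G.Adj u v

/-- An induced matching of maximum cardinality. -/
def SimpleGraph.IsMaximumInducedMatching {V : Type*} (G : SimpleGraph V)
    (M : Finset (Sym2 V)) : Prop :=
  G.IsInducedMatching M ∧ ∀ M' : Finset (Sym2 V), G.IsInducedMatching M' → M'.card ≤ M.card

/-! ## Trapezoid models and trapezoid graphs -/

/-- A (possibly degenerate) trapezoid between two parallel axes, cut out by the interval
`[x₁, x₂]` on one axis and the interval `[y₁, y₂]` on the other one. -/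
structure Trapezoid where
  x₁ : ℕ
  x₂ : ℕ
  y₁ : ℕ
  y₂ : ℕ
  hx : x₁ ≤ x₂
  hy : y₁ ≤ y₂

/-- The closed plane region of a trapezoid: the two axes are the horizontal lines at heights `0`
and `1`, and the legs join `x₁` to `y₁` and `x₂` to `y₂`. -/
def Trapezoid.region (A : Trapezoid) : Set (ℝ × ℝ) :=
  {p | 0 ≤ p.2 ∧ p.2 ≤ 1 ∧ (1 - p.2) * A.x₁ + p.2 * A.y₁ ≤ p.1 ∧
    p.1 ≤ (1 - p.2) * A.x₂ + p.2 * A.y₂}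

/-- A trapezoid model: `n` trapezoids labelled by `Fin n`, with all coordinates in `[1, 2n]`. -/
structure TrapezoidModel (n : ℕ) where
  trap : Fin n → Trapezoid
  one_le_x₁ : ∀ i, 1 ≤ (trap i).x₁
  x₂_le : ∀ i, (trap i).x₂ ≤ 2 * n
  one_le_y₁ : ∀ i, 1 ≤ (trap i).y₁
  y₂_le : ∀ i, (trap i).y₂ ≤ 2 * n

/-- The trapezoid graph of a model: two distinct labels are adjacent iff their trapezoids
intersect. -/
def TrapezoidModel.graph {n : ℕ} (τ : TrapezoidModel n) : SimpleGraph (Fin n) where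
  Adj i j := i ≠ j ∧ ((τ.trap i).region ∩ (τ.trap j).region).Nonempty
  symm := ⟨fun _ _ h => ⟨h.1.symm, by rw [Set.inter_comm]; exact h.2⟩⟩
  loopless := ⟨fun _ h => h.1 rfl⟩

/-! ## A unit-cost random access machine with bounded words -/

namespace WordRAM

/-- Machine state: registers, and a memory that is addressed by register contents. A program
mentions only finitely many registers. -/
structure State where
  reg : ℕ → ℕ
  mem : ℕ → ℕ

/-- Overwrite register `r` by `v`. -/
def State.setReg (s : State) (r v : ℕ) : State := { s with reg := Function.update s.reg r v }

/-- Overwrite memory cell `a` by `v`. -/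
def State.setMem (s : State) (a v : ℕ) : State := { s with mem := Function.update s.mem a v }

/-- Arithmetic instructions; subtraction is truncated at `0`, division rounds down. -/
inductive Op where
  | add | sub | mul | div | mod

/-- The value computed by an arithmetic instruction. -/
def Op.eval : Op → ℕ → ℕ → ℕ
  | .add, a, b => a + b
  | .sub, a, b => a - b
  | .mul, a, b => a * b
  | .div, a, b => a / b
  | .mod, a, b => a % b

/-- Programs. -/
inductive Prog where
  /-- do nothing -/
  | skip
  /-- `reg r := c` -/
  | const (r c : ℕ)
  /-- `reg r := reg a` -/
  | copy (r a : ℕ)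
  /-- `reg r := reg a ∘ reg b` -/
  | arith (o : Op) (r a b : ℕ)
  /-- `reg r := mem (reg a)` -/
  | load (r a : ℕ)
  /-- `mem (reg a) := reg b` -/
  | store (a b : ℕ)
  /-- first `p`, then `q` -/
  | seq (p q : Prog)
  /-- if `reg a < reg b` then `p` else `q` -/
  | ite (a b : ℕ) (p q : Prog)
  /-- while `reg a < reg b` do `p` -/
  | loop (a b : ℕ) (p : Prog)

/-- `Exec W p s s' t`: started in state `s`, the program `p` halts in state `s'` after exactly `t`
steps, and no constant and no arithmetic result in the run exceeds `W`. Every instruction and every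
evaluation of the test of a conditional or of a loop is one step. -/
inductive Exec (W : ℕ) : Prog → State → State → ℕ → Prop
  | skip (s : State) : Exec W .skip s s 1
  | const (s : State) (r c : ℕ) (h : c ≤ W) : Exec W (.const r c) s (s.setReg r c) 1
  | copy (s : State) (r a : ℕ) : Exec W (.copy r a) s (s.setReg r (s.reg a)) 1
  | arith (s : State) (o : Op) (r a b : ℕ) (h : o.eval (s.reg a) (s.reg b) ≤ W) :
      Exec W (.arith o r a b) s (s.setReg r (o.eval (s.reg a) (s.reg b))) 1
  | load (s : State) (r a : ℕ) : Exec W (.load r a) s (s.setReg r (s.mem (s.reg a))) 1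
  | store (s : State) (a b : ℕ) : Exec W (.store a b) s (s.setMem (s.reg a) (s.reg b)) 1
  | seq {p q : Prog} {s s' s'' : State} {t t' : ℕ} (h : Exec W p s s' t)
      (h' : Exec W q s' s'' t') : Exec W (.seq p q) s s'' (t + t')
  | ite_true {a b : ℕ} {p q : Prog} {s s' : State} {t : ℕ} (hab : s.reg a < s.reg b)
      (h : Exec W p s s' t) : Exec W (.ite a b p q) s s' (t + 1)
  | ite_false {a b : ℕ} {p q : Prog} {s s' : State} {t : ℕ} (hab : ¬ s.reg a < s.reg b)
      (h : Exec W q s s' t) : Exec W (.ite a b p q) s s' (t + 1)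
  | loop_true {a b : ℕ} {p : Prog} {s s' s'' : State} {t t' : ℕ} (hab : s.reg a < s.reg b)
      (h : Exec W p s s' t) (h' : Exec W (.loop a b p) s' s'' t') :
      Exec W (.loop a b p) s s'' (t + t' + 1)
  | loop_false {a b : ℕ} {p : Prog} {s : State} (hab : ¬ s.reg a < s.reg b) :
      Exec W (.loop a b p) s s 1

/-- A set `M` of unordered pairs of labels is the output of a halting state: register `0` contains
the number of pairs, register `1` an address, and from that address on the memory lists the pairs
one after the other, each pair once, by its two labels. -/
def State.Outputs {n : ℕ} (s : State) (M : Finset (Sym2 (Fin n))) : Prop :=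
  ∃ l : List (Fin n × Fin n),
    l.length = s.reg 0 ∧
    (∀ (i : ℕ) (hi : i < l.length),
      s.mem (s.reg 1 + 2 * i) = ((l[i]'hi).1 : ℕ) ∧
      s.mem (s.reg 1 + 2 * i + 1) = ((l[i]'hi).2 : ℕ)) ∧
    (l.map fun p => s(p.1, p.2)).Nodup ∧
    ∀ e, e ∈ M ↔ e ∈ l.map fun p => s(p.1, p.2)

end WordRAM

/-- The initial state for a trapezoid model: register `0` contains `n`, the memory cells
`4i, …, 4i + 3` contain the coordinates `x₁, x₂, y₁, y₂` of trapezoid `i`, everything else is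
`0`. -/
def TrapezoidModel.input {n : ℕ} (τ : TrapezoidModel n) : WordRAM.State where
  reg r := if r = 0 then n else 0
  mem a :=
    if h : a / 4 < n then
      match a % 4 with
      | 0 => (τ.trap ⟨a / 4, h⟩).x₁
      | 1 => (τ.trap ⟨a / 4, h⟩).x₂
      | 2 => (τ.trap ⟨a / 4, h⟩).y₁
      | _ => (τ.trap ⟨a / 4, h⟩).y₂
    else 0

/-!
Say that a trapezoid is *before* another one if it lies entirely to its left on both axes. Two
trapezoids are adjacent iff neither is before the other (`adj_iff`), and of two edges of an induced
matching one lies entirely to the left of the other. So a maximum induced matching is a longest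
chain of edges, where `e` precedes `f` if both ends of `e` are before both ends of `f`
(`exists_chainEnd`, `isInducedMatching_of_pairwise`).

The program sweeps over the first axis. It maintains the thresholds `T k`: among the chains of `k`
edges whose last edge has been completed, `T k` is the least point of the second axis up to which
a last edge reaches. The thresholds increase strictly with `k`. At the left end of a trapezoid `u`
the longest chain before `u` is found by going through the thresholds from the top. The thresholds
passed on the way belong to different neighbours of `u`, so this takes `O(deg u)` steps
(`Thresholds.sub_le_deg`). The length `R u` of the chain, the point `V u` that it reaches and its
last edge are recorded.

At the right end of a trapezoid `v` all edges from `v` to trapezoids with smaller right end are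
enumerated. The candidates `w` are those whose right end on one of the two axes is not left of the
left end of `v`, and they form final segments of two sorted arrays, so that they are found in
`O(deg v)` steps (`wp_scan`). Insertion of `v` into the arrays moves only neighbours of `v`.

For an edge `uo`, where `u` has the smaller left end on the first axis, the longest chain before
both `u` and `o` would be needed, which seems to require a search for every edge. The observation
that saves this search is that only the chain recorded for `u` matters: if that chain is not before
`o`, then it has at least as many edges as any chain with last edge `uo`, and it reaches less far
on both axes, so the edge `uo` is dispensable (`Thresholds.covered_of_le`). Otherwise `uo` closes a
chain of `R u + 1` edges and a single threshold has to be compared and updated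
(`Thresholds.update`).

Every step is thus paid by an end of a trapezoid or by a neighbour, and the degrees add up to twice
the number of edges. The run is followed by means of a weakest-precondition calculus `wp` for a
small language of expressions, assignments, conditionals and loops that is translated to the
instructions of the machine.
-/

/-! ### Expressions and their compilation -/

namespace WordRAM

/-- Arithmetic expressions over the registers and the memory. The memory is viewed as a low part
(the cells below `4 * n`) and sixteen interleaved infinite tables above it. -/
inductive Expr where
  | lit (c : ℕ)
  | var (r : ℕ)
  | bin (o : Op) (e f : Expr)
  /-- the content of a cell of the low part of the memory -/
  | low (e : Expr)
  /-- the content of a cell of table `j` -/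
  | tab (j : ℕ) (e : Expr)

namespace Expr

instance : Add Expr := ⟨bin .add⟩
instance : Sub Expr := ⟨bin .sub⟩
instance : Mul Expr := ⟨bin .mul⟩
instance : Div Expr := ⟨bin .div⟩
instance : Mod Expr := ⟨bin .mod⟩
instance (k : ℕ) : OfNat Expr k := ⟨lit k⟩

end Expr

/-- An abstract machine state: the registers below `32` as variables, the low part of the memory
and the tables. -/
structure Store where
  var : ℕ → ℕ
  low : ℕ → ℕ
  tab : ℕ → ℕ → ℕ

namespace Store

/-- Assign `x` to the variable `r`. -/
def set (h : Store) (r x : ℕ) : Store := { h with var := Function.update h.var r x }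

/-- Overwrite the low cell `a` by `x`. -/
def setLow (h : Store) (a x : ℕ) : Store := { h with low := Function.update h.low a x }

/-- Overwrite cell `i` of table `j` by `x`. -/
def setTab (h : Store) (j i x : ℕ) : Store :=
  { h with tab := Function.update h.tab j (Function.update (h.tab j) i x) }

variable (h : Store) (r x a j i : ℕ)

@[simp] theorem set_low : (h.set r x).low = h.low := rfl
@[simp] theorem set_tab : (h.set r x).tab = h.tab := rfl
@[simp] theorem set_var (r' : ℕ) : (h.set r x).var r' = if r' = r then x else h.var r' :=
  Function.update_apply ..
@[simp] theorem setLow_var : (h.setLow a x).var = h.var := rfl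
@[simp] theorem setLow_tab : (h.setLow a x).tab = h.tab := rfl
@[simp] theorem setLow_low : (h.setLow a x).low = Function.update h.low a x := rfl
@[simp] theorem setTab_var : (h.setTab j i x).var = h.var := rfl
@[simp] theorem setTab_low : (h.setTab j i x).low = h.low := rfl
@[simp] theorem setTab_tab (j' : ℕ) : (h.setTab j i x).tab j' =
    if j' = j then Function.update (h.tab j) i x else h.tab j' :=
  Function.update_apply ..

end Store

namespace Expr

/-- The value of an expression. -/
def eval (h : Store) : Expr → ℕ
  | lit c => c
  | var r => h.var r
  | bin o e f => o.eval (e.eval h) (f.eval h)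
  | low e => h.low (e.eval h)
  | tab j e => h.tab j (e.eval h)

/-- The number of machine steps that evaluate an expression. -/
def cost : Expr → ℕ
  | lit _ => 1
  | var _ => 1
  | bin _ e f => e.cost + f.cost + 1
  | low e => e.cost + 1
  | tab _ e => e.cost + 8

/-- The evaluation of the expression stays within the word bound `W` and the part of the memory
that the `Store` describes. -/
def Ok (W n : ℕ) (h : Store) : Expr → Prop
  | lit c => c ≤ W
  | var r => r < 32
  | bin o e f => e.Ok W n h ∧ f.Ok W n h ∧ o.eval (e.eval h) (f.eval h) ≤ W
  | low e => e.Ok W n h ∧ e.eval h < 4 * n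
  | tab j e => e.Ok W n h ∧ j < 16 ∧ 16 * e.eval h + 4 * n + 16 ≤ W

section
variable (W n : ℕ) (h : Store) (e f : Expr) (r j k : ℕ)

@[simp] theorem eval_ofNat : eval h ofNat(k) = OfNat.ofNat k := rfl
@[simp] theorem eval_var : eval h (var r) = h.var r := rfl
@[simp] theorem eval_low : eval h (low e) = h.low (e.eval h) := rfl
@[simp] theorem eval_tab : eval h (tab j e) = h.tab j (e.eval h) := rfl
@[simp] theorem eval_add : eval h (e + f) = e.eval h + f.eval h := rfl
@[simp] theorem eval_sub : eval h (e - f) = e.eval h - f.eval h := rfl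
@[simp] theorem eval_mul : eval h (e * f) = e.eval h * f.eval h := rfl
@[simp] theorem eval_div : eval h (e / f) = e.eval h / f.eval h := rfl
@[simp] theorem eval_mod : eval h (e % f) = e.eval h % f.eval h := rfl

@[simp] theorem cost_ofNat : cost ofNat(k) = 1 := rfl
@[simp] theorem cost_var : cost (var r) = 1 := rfl
@[simp] theorem cost_low : cost (low e) = e.cost + 1 := rfl
@[simp] theorem cost_tab : cost (tab j e) = e.cost + 8 := rfl
@[simp] theorem cost_add : cost (e + f) = e.cost + f.cost + 1 := rfl
@[simp] theorem cost_sub : cost (e - f) = e.cost + f.cost + 1 := rfl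
@[simp] theorem cost_mul : cost (e * f) = e.cost + f.cost + 1 := rfl
@[simp] theorem cost_div : cost (e / f) = e.cost + f.cost + 1 := rfl
@[simp] theorem cost_mod : cost (e % f) = e.cost + f.cost + 1 := rfl

@[simp] theorem ok_ofNat : Ok W n h ofNat(k) ↔ OfNat.ofNat k ≤ W := Iff.rfl
@[simp] theorem ok_var : Ok W n h (var r) ↔ r < 32 := Iff.rfl
@[simp] theorem ok_low : Ok W n h (low e) ↔ e.Ok W n h ∧ e.eval h < 4 * n := Iff.rfl
@[simp] theorem ok_tab : Ok W n h (tab j e) ↔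
    e.Ok W n h ∧ j < 16 ∧ 16 * e.eval h + 4 * n + 16 ≤ W := Iff.rfl
@[simp] theorem ok_add : Ok W n h (e + f) ↔
    e.Ok W n h ∧ f.Ok W n h ∧ e.eval h + f.eval h ≤ W := Iff.rfl
@[simp] theorem ok_sub : Ok W n h (e - f) ↔
    e.Ok W n h ∧ f.Ok W n h ∧ e.eval h - f.eval h ≤ W := Iff.rfl
@[simp] theorem ok_mul : Ok W n h (e * f) ↔
    e.Ok W n h ∧ f.Ok W n h ∧ e.eval h * f.eval h ≤ W := Iff.rfl
@[simp] theorem ok_div : Ok W n h (e / f) ↔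
    e.Ok W n h ∧ f.Ok W n h ∧ e.eval h / f.eval h ≤ W := Iff.rfl
@[simp] theorem ok_mod : Ok W n h (e % f) ↔
    e.Ok W n h ∧ f.Ok W n h ∧ e.eval h % f.eval h ≤ W := Iff.rfl
end

end Expr

/-- `Prog.seq` as an infix operator. -/
infixr:60 " ;; " => Prog.seq

/-- Turn the index of a cell of table `j`, held in register `d`, into the address of the cell;
register `0` has to contain `n`. -/
def tabAddr (j d : ℕ) : Prog :=
  .const (d + 1) 16 ;; .arith .mul d d (d + 1) ;; .const (d + 1) 4 ;;
    .arith .mul (d + 1) (d + 1) 0 ;; .arith .add d d (d + 1) ;; .const (d + 1) j ;;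
    .arith .add d d (d + 1)

/-- The program that evaluates an expression into register `d`, with the registers above `d` as
scratch space. -/
def Expr.comp : Expr → ℕ → Prog
  | .lit c, d => .const d c
  | .var r, d => .copy d r
  | .bin o e f, d => e.comp d ;; f.comp (d + 1) ;; .arith o d d (d + 1)
  | .low e, d => e.comp d ;; .load d d
  | .tab j e, d => e.comp d ;; tabAddr j d ;; .load d d

/-- The machine state `s` realizes the store `h`; registers from `32` on are scratch space. -/
structure Represents (n : ℕ) (h : Store) (s : State) : Prop where
  zero : h.var 0 = n
  var : ∀ r < 32, s.reg r = h.var r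
  low : ∀ a < 4 * n, s.mem a = h.low a
  tab : ∀ j < 16, ∀ i, s.mem (16 * i + 4 * n + j) = h.tab j i

theorem Represents.congr {n : ℕ} {h : Store} {s s' : State} (hs : Represents n h s)
    (hm : s'.mem = s.mem) (hr : ∀ r < 32, s'.reg r = s.reg r) : Represents n h s' where
  zero := hs.zero
  var r hr' := (hr r hr').trans (hs.var r hr')
  low a ha := by rw [hm, hs.low a ha]
  tab j hj i := by rw [hm, hs.tab j hj i]

theorem exec_tabAddr {W n j i d : ℕ} {h : Store} {s : State} (hs : Represents n h s)
    (hi : s.reg d = i) (hj : j < 16) (hW : 16 * i + 4 * n + 16 ≤ W) (hd : 32 ≤ d) :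
    ∃ s', Exec W (tabAddr j d) s s' 7 ∧ s'.mem = s.mem ∧ (∀ r < d, s'.reg r = s.reg r) ∧
      s'.reg d = 16 * i + 4 * n + j := by
  have h0 : s.reg 0 = n := (hs.var 0 (by norm_num)).trans hs.zero
  have hd0 : d ≠ 0 := by omega
  refine ⟨_, .seq (.const _ _ _ (by omega)) (.seq (.arith _ _ _ _ _ ?_) (.seq (.const _ _ _ ?_)
    (.seq (.arith _ _ _ _ _ ?_) (.seq (.arith _ _ _ _ _ ?_) (.seq (.const _ _ _ ?_)
    (.arith _ _ _ _ _ ?_)))))), rfl, ?_, ?_⟩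
  · simp [State.setReg, Op.eval, hi]; omega
  · omega
  · simp [State.setReg, Op.eval, hd0.symm, h0]; omega
  · simp [State.setReg, Op.eval, hd0.symm, h0, hi]; omega
  · omega
  · simp [State.setReg, Op.eval, hd0.symm, h0, hi]; omega
  · intro r hr
    have h1 : r ≠ d := by omega
    have h2 : r ≠ d + 1 := by omega
    simp [State.setReg, h1, h2]
  · simp [State.setReg, Op.eval, hd0.symm, h0, hi]; omega

theorem exec_comp {W n : ℕ} {h : Store} (e : Expr) : ∀ {s : State} {d : ℕ}, Represents n h s →
    e.Ok W n h → 32 ≤ d →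
    ∃ s', Exec W (e.comp d) s s' e.cost ∧ s'.mem = s.mem ∧ (∀ r < d, s'.reg r = s.reg r) ∧
      s'.reg d = e.eval h := by
  have hset : ∀ (s : State) (d x : ℕ), ∀ r < d, (s.setReg d x).reg r = s.reg r := by
    intro s d x r hr; simp [State.setReg, hr.ne]
  induction e with
  | lit c =>
    intro s d _ hok _
    exact ⟨_, .const _ _ _ hok, rfl, hset _ _ _, by simp [State.setReg, Expr.eval]⟩
  | var r =>
    intro s d hs hok _
    refine ⟨_, .copy _ _ _, rfl, hset _ _ _, ?_⟩
    simp [State.setReg, Expr.eval, hs.var r hok]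
  | bin o e f ihe ihf =>
    intro s d hs hok hd
    obtain ⟨s₁, x₁, m₁, r₁, v₁⟩ := ihe hs hok.1 hd
    obtain ⟨s₂, x₂, m₂, r₂, v₂⟩ := ihf (d := d + 1)
      (hs.congr m₁ fun r hr => r₁ r (by omega)) hok.2.1 (by omega)
    have hv : s₂.reg d = e.eval h := (r₂ d (by omega)).trans v₁
    have x₃ := Exec.arith (W := W) s₂ o d d (d + 1) (by rw [hv, v₂]; exact hok.2.2)
    refine ⟨s₂.setReg d (o.eval (s₂.reg d) (s₂.reg (d + 1))), ?_, m₂.trans m₁, ?_, ?_⟩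
    · simpa [Expr.cost, Expr.comp, add_assoc] using Exec.seq x₁ (.seq x₂ x₃)
    · intro r hr
      rw [hset _ _ _ r hr, r₂ r (by omega), r₁ r hr]
    · simp [State.setReg, hv, v₂, Expr.eval]
  | low e ih =>
    intro s d hs hok hd
    obtain ⟨s₁, x₁, m₁, r₁, v₁⟩ := ih hs hok.1 hd
    refine ⟨_, .seq x₁ (.load _ _ _), m₁, ?_, ?_⟩
    · intro r hr
      rw [hset _ _ _ r hr, r₁ r hr]
    · simp [State.setReg, v₁, m₁, Expr.eval, hs.low _ hok.2]
  | tab j e ih =>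
    intro s d hs hok hd
    obtain ⟨s₁, x₁, m₁, r₁, v₁⟩ := ih hs hok.1 hd
    obtain ⟨s₂, x₂, m₂, r₂, v₂⟩ := exec_tabAddr (j := j) (d := d)
      (hs.congr m₁ fun r hr => r₁ r (by omega)) v₁ hok.2.1 hok.2.2 hd
    refine ⟨_, .seq x₁ (.seq x₂ (.load _ _ _)), (m₂.trans m₁ :), ?_, ?_⟩
    · intro r hr
      rw [hset _ _ _ r hr, r₂ r hr, r₁ r hr]
    · simp [State.setReg, v₂, m₂, m₁, Expr.eval, hs.tab j hok.2.1]

/-! ### Structured programs and their proof rules -/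

/-- `v := e` -/
def asg (v : ℕ) (e : Expr) : Prog := e.comp 32 ;; .copy v 32

/-- Store `f` in the low cell `e`. -/
def stLow (e f : Expr) : Prog := e.comp 32 ;; f.comp 33 ;; .store 32 33

/-- Store `f` in cell `e` of table `j`. -/
def stTab (j : ℕ) (e f : Expr) : Prog := e.comp 32 ;; tabAddr j 32 ;; f.comp 33 ;; .store 32 33

/-- If `e < f` then `p` else `q`. -/
def cond (e f : Expr) (p q : Prog) : Prog := e.comp 32 ;; f.comp 33 ;; .ite 32 33 p q

/-- While `e < f` do `p`. -/
def while_ (e f : Expr) (p : Prog) : Prog :=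
  e.comp 32 ;; f.comp 33 ;; .loop 32 33 (p ;; e.comp 32 ;; f.comp 33)

/-- The weakest precondition of a program: started at time `t` in any machine state that represents
`h`, the program `p` halts, at a time and in a state that represents a store for which `Q` holds. -/
def wp (W n : ℕ) (p : Prog) (Q : Store → ℕ → Prop) (h : Store) (t : ℕ) : Prop :=
  ∀ s, Represents n h s → ∃ s' h' k, Exec W p s s' k ∧ Represents n h' s' ∧ Q h' (t + k)

section rules
variable {W n : ℕ} {p q : Prog} {Q Q' : Store → ℕ → Prop} {h : Store} {t : ℕ} {e f : Expr}

theorem wp_mono (H : wp W n p Q' h t) (hQ : ∀ h t, Q' h t → Q h t) : wp W n p Q h t := by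
  intro s hs
  obtain ⟨s', h', k, x, r, H⟩ := H s hs
  exact ⟨s', h', k, x, r, hQ _ _ H⟩

theorem wp_seq (H : wp W n p (wp W n q Q) h t) : wp W n (p ;; q) Q h t := by
  intro s hs
  obtain ⟨s₁, h₁, k₁, x₁, r₁, H⟩ := H s hs
  obtain ⟨s₂, h₂, k₂, x₂, r₂, H⟩ := H s₁ r₁
  exact ⟨s₂, h₂, _, .seq x₁ x₂, r₂, by rwa [← add_assoc]⟩

theorem wp_skip (H : Q h (t + 1)) : wp W n .skip Q h t :=
  fun s hs => ⟨s, h, 1, .skip s, hs, H⟩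

theorem wp_asg {v : ℕ} (hv : 0 < v ∧ v < 32) (hok : e.Ok W n h)
    (H : Q (h.set v (e.eval h)) (t + (e.cost + 1))) : wp W n (asg v e) Q h t := by
  intro s hs
  obtain ⟨s₁, x₁, m₁, r₁, v₁⟩ := exec_comp e hs hok (le_refl 32)
  refine ⟨_, _, _, .seq x₁ (.copy _ _ _), ⟨?_, ?_, ?_, ?_⟩, H⟩
  · simp [hs.zero, hv.1.ne]
  · intro r hr
    by_cases hrv : r = v
    · simp [State.setReg, hrv, v₁]
    · simp [State.setReg, hrv, r₁ r hr, hs.var r hr]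
  · intro a ha; simp [State.setReg, m₁, hs.low a ha]
  · intro j hj i; simp [State.setReg, m₁, hs.tab j hj i]

theorem wp_stLow (hoke : e.Ok W n h) (hokf : f.Ok W n h) (he : e.eval h < 4 * n)
    (H : Q (h.setLow (e.eval h) (f.eval h)) (t + (e.cost + f.cost + 1))) :
    wp W n (stLow e f) Q h t := by
  intro s hs
  obtain ⟨s₁, x₁, m₁, r₁, v₁⟩ := exec_comp e hs hoke (le_refl 32)
  have hs₁ := hs.congr m₁ r₁
  obtain ⟨s₂, x₂, m₂, r₂, v₂⟩ := exec_comp (d := 33) f hs₁ hokf (by norm_num)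
  have hs₂ := hs₁.congr m₂ fun r hr => r₂ r (by omega)
  have hv : s₂.reg 32 = e.eval h := (r₂ 32 (by norm_num)).trans v₁
  refine ⟨_, h.setLow (e.eval h) (f.eval h), _, .seq x₁ (.seq x₂ (.store _ _ _)),
    ⟨hs.zero, hs₂.var, ?_, ?_⟩, ?_⟩
  · intro a ha
    by_cases hae : a = e.eval h <;> simp [State.setMem, hv, v₂, hae, hs₂.low a ha]
  · intro j hj i
    have : 16 * i + 4 * n + j ≠ e.eval h := by omega
    simp [State.setMem, hv, v₂, this, hs₂.tab j hj i]
  · rwa [← add_assoc (Expr.cost e)]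

theorem wp_stTab {j : ℕ} (hoke : e.Ok W n h) (hokf : f.Ok W n h) (hj : j < 16)
    (he : 16 * e.eval h + 4 * n + 16 ≤ W)
    (H : Q (h.setTab j (e.eval h) (f.eval h)) (t + (e.cost + f.cost + 8))) :
    wp W n (stTab j e f) Q h t := by
  intro s hs
  obtain ⟨s₁, x₁, m₁, r₁, v₁⟩ := exec_comp e hs hoke (le_refl 32)
  have hs₁ := hs.congr m₁ r₁
  obtain ⟨s₃, x₃, m₃, r₃, v₃⟩ := exec_tabAddr (j := j) hs₁ v₁ hj he (le_refl 32)
  have hs₃ := hs₁.congr m₃ r₃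
  obtain ⟨s₂, x₂, m₂, r₂, v₂⟩ := exec_comp (d := 33) f hs₃ hokf (by norm_num)
  have hs₂ := hs₃.congr m₂ fun r hr => r₂ r (by omega)
  have hv : s₂.reg 32 = 16 * e.eval h + 4 * n + j := (r₂ 32 (by norm_num)).trans v₃
  refine ⟨_, h.setTab j (e.eval h) (f.eval h), _, .seq x₁ (.seq x₃ (.seq x₂ (.store _ _ _))),
    ⟨hs.zero, hs₂.var, ?_, ?_⟩, ?_⟩
  · intro a ha
    have : a ≠ 16 * e.eval h + 4 * n + j := by omega
    simp [State.setMem, hv, v₂, this, hs₂.low a ha]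
  · intro j' hj' i
    by_cases hjj : j' = j
    · subst hjj
      by_cases hie : i = e.eval h
      · simp [State.setMem, hv, v₂, hie]
      · have : 16 * i + 4 * n + j' ≠ 16 * e.eval h + 4 * n + j' := by omega
        simp [State.setMem, hv, v₂, hie, hs₂.tab j' hj i]
    · have : 16 * i + 4 * n + j' ≠ 16 * e.eval h + 4 * n + j := by omega
      simp [State.setMem, hv, v₂, this, hjj, hs₂.tab j' hj' i]
  · have h1 : e.cost + (7 + (f.cost + 1)) = e.cost + f.cost + 8 := by ring
    rwa [h1]

theorem wp_cond (hoke : e.Ok W n h) (hokf : f.Ok W n h)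
    (H₁ : e.eval h < f.eval h → wp W n p Q h (t + (e.cost + f.cost + 1)))
    (H₂ : ¬ e.eval h < f.eval h → wp W n q Q h (t + (e.cost + f.cost + 1))) :
    wp W n (cond e f p q) Q h t := by
  intro s hs
  obtain ⟨s₁, x₁, m₁, r₁, v₁⟩ := exec_comp e hs hoke (le_refl 32)
  have hs₁ := hs.congr m₁ r₁
  obtain ⟨s₂, x₂, m₂, r₂, v₂⟩ := exec_comp (d := 33) f hs₁ hokf (by norm_num)
  have hs₂ := hs₁.congr m₂ fun r hr => r₂ r (by omega)
  have hv : s₂.reg 32 = e.eval h := (r₂ 32 (by norm_num)).trans v₁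
  by_cases hlt : e.eval h < f.eval h
  · obtain ⟨s', h', k, x, r, H⟩ := H₁ hlt s₂ hs₂
    refine ⟨s', h', _, .seq x₁ (.seq x₂ (.ite_true (by rwa [hv, v₂]) x)), r, ?_⟩
    convert H using 1; ring
  · obtain ⟨s', h', k, x, r, H⟩ := H₂ hlt s₂ hs₂
    refine ⟨s', h', _, .seq x₁ (.seq x₂ (.ite_false (by rwa [hv, v₂]) x)), r, ?_⟩
    convert H using 1; ring

/-- The rule for loops: `I` is an invariant that holds whenever the test is about to be evaluated,
and `μ` decreases in every round. -/
theorem wp_while (I : Store → ℕ → Prop) (μ : Store → ℕ) (h0 : I h t)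
    (hok : ∀ h t, I h t → e.Ok W n h ∧ f.Ok W n h)
    (hbody : ∀ h t, I h t → e.eval h < f.eval h →
      wp W n p (fun h' t' => I h' t' ∧ μ h' < μ h) h (t + (e.cost + f.cost + 1)))
    (hexit : ∀ h t, I h t → ¬ e.eval h < f.eval h → Q h (t + (e.cost + f.cost + 1))) :
    wp W n (while_ e f p) Q h t := by
  have key : ∀ m h t, μ h = m → I h t → ∀ s, Represents n h s → s.reg 32 = e.eval h →
      s.reg 33 = f.eval h → ∃ s' h' k, Exec W (.loop 32 33 (p ;; e.comp 32 ;; f.comp 33)) s s' k ∧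
        Represents n h' s' ∧ Q h' (t + (e.cost + f.cost) + k) := by
    intro m
    induction m using Nat.strong_induction_on with
    | _ m ih =>
      intro h t hm hI s hs he hf
      by_cases hlt : e.eval h < f.eval h
      · obtain ⟨s₀, h₀, k₀, x₀, r₀, hI₀, hμ⟩ := hbody h t hI hlt s hs
        obtain ⟨oke, okf⟩ := hok _ _ hI₀
        obtain ⟨s₁, x₁, m₁, r₁, v₁⟩ := exec_comp e r₀ oke (le_refl 32)
        have hs₁ := r₀.congr m₁ r₁
        obtain ⟨s₂, x₂, m₂, r₂, v₂⟩ := exec_comp (d := 33) f hs₁ okf (by norm_num)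
        have hs₂ := hs₁.congr m₂ fun r hr => r₂ r (by omega)
        obtain ⟨s', h', k, x, r, H⟩ := ih _ (hm ▸ hμ) h₀ _ rfl hI₀ s₂ hs₂
          ((r₂ 32 (by norm_num)).trans v₁) v₂
        refine ⟨s', h', _, .loop_true (by rwa [he, hf]) (.seq x₀ (.seq x₁ x₂)) x, r, ?_⟩
        convert H using 1; ring
      · exact ⟨s, h, 1, .loop_false (by rwa [he, hf]), hs, by
          rw [add_assoc]; exact hexit h t hI hlt⟩
  intro s hs
  obtain ⟨oke, okf⟩ := hok _ _ h0
  obtain ⟨s₁, x₁, m₁, r₁, v₁⟩ := exec_comp e hs oke (le_refl 32)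
  have hs₁ := hs.congr m₁ r₁
  obtain ⟨s₂, x₂, m₂, r₂, v₂⟩ := exec_comp (d := 33) f hs₁ okf (by norm_num)
  have hs₂ := hs₁.congr m₂ fun r hr => r₂ r (by omega)
  obtain ⟨s', h', k, x, r, H⟩ := key _ h t rfl h0 s₂ hs₂ ((r₂ 32 (by norm_num)).trans v₁) v₂
  refine ⟨s', h', _, .seq x₁ (.seq x₂ x), r, ?_⟩
  convert H using 1; ring

end rules

end WordRAM

namespace TrapezoidModel

variable {n : ℕ} (τ : TrapezoidModel n)

/-! ### The order of the trapezoids and chains of edges -/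

/-- Trapezoid `i` lies entirely to the left of trapezoid `j`. -/
def Before (i j : Fin n) : Prop :=
  (τ.trap i).x₂ < (τ.trap j).x₁ ∧ (τ.trap i).y₂ < (τ.trap j).y₁

variable {τ}

theorem Before.trans {i j k : Fin n} (h : τ.Before i j) (h' : τ.Before j k) : τ.Before i k := by
  have := (τ.trap j).hx
  have := (τ.trap j).hy
  have := h.1; have := h.2; have := h'.1; have := h'.2
  exact ⟨by omega, by omega⟩

theorem Before.irrefl (i : Fin n) : ¬ τ.Before i i := by
  intro h
  have := (τ.trap i).hx
  have := h.1
  omega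

theorem Before.inter_region {i j : Fin n} (h : τ.Before i j) :
    (τ.trap i).region ∩ (τ.trap j).region = ∅ := by
  rw [Set.eq_empty_iff_forall_notMem]
  rintro p ⟨⟨h0, h1, -, h3⟩, ⟨-, -, h4, -⟩⟩
  have hx : ((τ.trap i).x₂ : ℝ) + 1 ≤ (τ.trap j).x₁ := by exact_mod_cast h.1
  have hy : ((τ.trap i).y₂ : ℝ) + 1 ≤ (τ.trap j).y₁ := by exact_mod_cast h.2
  nlinarith [mul_le_mul_of_nonneg_left hx (sub_nonneg.2 h1), mul_le_mul_of_nonneg_left hy h0]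

/-- If the right leg of `A` is left of the left leg of `B` on the first axis only, the two legs
cross. -/
theorem _root_.Trapezoid.region_inter_of_cross {A B : Trapezoid} (hx : A.x₂ < B.x₁)
    (hy : B.y₁ ≤ A.y₂) : (A.region ∩ B.region).Nonempty := by
  have hx' : (A.x₂ : ℝ) < B.x₁ := by exact_mod_cast hx
  have hy' : (B.y₁ : ℝ) ≤ A.y₂ := by exact_mod_cast hy
  have h1 : (A.x₁ : ℝ) ≤ A.x₂ := by exact_mod_cast A.hx
  have h2 : (A.y₁ : ℝ) ≤ A.y₂ := by exact_mod_cast A.hy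
  have h3 : (B.x₁ : ℝ) ≤ B.x₂ := by exact_mod_cast B.hx
  have h4 : (B.y₁ : ℝ) ≤ B.y₂ := by exact_mod_cast B.hy
  have hD : (0 : ℝ) < (B.x₁ - A.x₂) + (A.y₂ - B.y₁) := by linarith
  -- the height of the crossing point of the two legs
  obtain ⟨s, hs⟩ : ∃ s : ℝ, s * ((B.x₁ - A.x₂) + (A.y₂ - B.y₁)) = B.x₁ - A.x₂ :=
    ⟨_, div_mul_cancel₀ _ hD.ne'⟩
  have hs0 : 0 ≤ s := by
    by_contra hneg
    nlinarith [mul_neg_of_neg_of_pos (not_le.1 hneg) hD]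
  have hs1 : s ≤ 1 := by
    by_contra hgt
    nlinarith [mul_lt_mul_of_pos_right (not_le.1 hgt) hD]
  have hs1' : 0 ≤ 1 - s := by linarith
  refine ⟨((1 - s) * A.x₂ + s * A.y₂, s), ⟨hs0, hs1, ?_, le_refl _⟩, ⟨hs0, hs1, ?_, ?_⟩⟩
  · show (1 - s) * (A.x₁ : ℝ) + s * A.y₁ ≤ (1 - s) * A.x₂ + s * A.y₂
    nlinarith [mul_le_mul_of_nonneg_left h1 hs1', mul_le_mul_of_nonneg_left h2 hs0]
  · show (1 - s) * (B.x₁ : ℝ) + s * B.y₁ ≤ (1 - s) * A.x₂ + s * A.y₂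
    nlinarith
  · show (1 - s) * (A.x₂ : ℝ) + s * A.y₂ ≤ (1 - s) * B.x₂ + s * B.y₂
    nlinarith [mul_le_mul_of_nonneg_left h3 hs1', mul_le_mul_of_nonneg_left h4 hs0]

/-- As `Trapezoid.region_inter_of_cross`, with the two axes exchanged. -/
theorem _root_.Trapezoid.region_inter_of_cross' {A B : Trapezoid} (hx : B.x₁ ≤ A.x₂)
    (hy : A.y₂ < B.y₁) : (A.region ∩ B.region).Nonempty := by
  obtain ⟨p, hA, hB⟩ := Trapezoid.region_inter_of_cross (A := ⟨A.y₁, A.y₂, A.x₁, A.x₂, A.hy, A.hx⟩)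
    (B := ⟨B.y₁, B.y₂, B.x₁, B.x₂, B.hy, B.hx⟩) hy hx
  simp only [Trapezoid.region, Set.mem_ofPred_eq] at hA hB
  obtain ⟨a1, a2, a3, a4⟩ := hA
  obtain ⟨b1, b2, b3, b4⟩ := hB
  refine ⟨(p.1, 1 - p.2), ?_, ?_⟩ <;> simp only [Trapezoid.region, Set.mem_ofPred_eq] <;>
    refine ⟨?_, ?_, ?_, ?_⟩ <;> linarith

theorem adj_iff {i j : Fin n} :
    τ.graph.Adj i j ↔ i ≠ j ∧ ¬ τ.Before i j ∧ ¬ τ.Before j i := by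
  constructor
  · rintro ⟨hij, hne⟩
    refine ⟨hij, fun h => ?_, fun h => ?_⟩
    · rw [h.inter_region] at hne; exact Set.not_nonempty_empty hne
    · rw [Set.inter_comm, h.inter_region] at hne; exact Set.not_nonempty_empty hne
  · rintro ⟨hij, h1, h2⟩
    refine ⟨hij, ?_⟩
    have cross : ∀ A B : Trapezoid, ¬ (A.x₂ < B.x₁ ∧ A.y₂ < B.y₁) →
        A.x₂ < B.x₁ ∨ A.y₂ < B.y₁ → (A.region ∩ B.region).Nonempty := by
      intro A B h h'
      rcases h' with h' | h'
      · exact Trapezoid.region_inter_of_cross h' (by omega)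
      · exact Trapezoid.region_inter_of_cross' (by omega) h'
    by_cases c1 : (τ.trap i).x₂ < (τ.trap j).x₁ ∨ (τ.trap i).y₂ < (τ.trap j).y₁
    · exact cross _ _ h1 c1
    by_cases c2 : (τ.trap j).x₂ < (τ.trap i).x₁ ∨ (τ.trap j).y₂ < (τ.trap i).y₁
    · rw [Set.inter_comm]; exact cross _ _ h2 c2
    -- otherwise the two trapezoids meet on the first axis
    push Not at c1 c2
    refine ⟨((max (τ.trap i).x₁ (τ.trap j).x₁ : ℕ), 0), ⟨le_refl _, zero_le_one, ?_, ?_⟩,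
      ⟨le_refl _, zero_le_one, ?_, ?_⟩⟩
    all_goals
      have := (τ.trap i).hx
      have := (τ.trap j).hx
      simp only [sub_zero, one_mul, zero_mul, add_zero]
      exact_mod_cast (by omega)

variable (τ) in
/-- `τ.ChainEnd k w v`: there is a chain of `k` edges, each entirely to the left of the next one,
whose last edge is `wv`. -/
inductive ChainEnd : ℕ → Fin n → Fin n → Prop
  | single {w v : Fin n} (h : τ.graph.Adj w v) : ChainEnd 1 w v
  | snoc {k : ℕ} {a b w v : Fin n} (hc : ChainEnd k a b) (h : τ.graph.Adj w v)
      (haw : τ.Before a w) (hav : τ.Before a v) (hbw : τ.Before b w) (hbv : τ.Before b v) :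
      ChainEnd (k + 1) w v

theorem ChainEnd.comm {k : ℕ} {w v : Fin n} (h : τ.ChainEnd k w v) : τ.ChainEnd k v w := by
  cases h with
  | single h => exact .single h.symm
  | snoc hc h haw hav hbw hbv => exact .snoc hc h.symm hav haw hbv hbw

theorem ChainEnd.adj {k : ℕ} {w v : Fin n} (h : τ.ChainEnd k w v) : τ.graph.Adj w v := by
  cases h <;> assumption

/-- Two edges of an induced matching are separated: one of them is entirely to the left of the
other. -/
theorem before_or_before {M : Finset (Sym2 (Fin n))} (hM : τ.graph.IsInducedMatching M)
    {a b c d : Fin n} (h₁ : s(a, b) ∈ M) (h₂ : s(c, d) ∈ M) (hne : s(a, b) ≠ s(c, d)) :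
    (τ.Before a c ∧ τ.Before a d ∧ τ.Before b c ∧ τ.Before b d) ∨
      (τ.Before c a ∧ τ.Before d a ∧ τ.Before c b ∧ τ.Before d b) := by
  have hab : τ.graph.Adj a b := hM.1 _ h₁
  have hcd : τ.graph.Adj c d := hM.1 _ h₂
  have sep : ∀ u ∈ s(a, b), ∀ v ∈ s(c, d), τ.Before u v ∨ τ.Before v u := by
    intro u hu v hv
    by_contra hcon
    push Not at hcon
    have huv : u ≠ v := by
      rintro rfl
      -- a common endpoint of the two edges is adjacent to the other endpoint of one of them
      rcases Sym2.mem_iff.1 hu with rfl | rfl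
      · exact hM.2 _ h₁ _ h₂ hne b (Sym2.mem_mk_right _ _) u hv hab.symm
      · exact hM.2 _ h₁ _ h₂ hne a (Sym2.mem_mk_left _ _) u hv hab
    exact hM.2 _ h₁ _ h₂ hne u hu v hv (adj_iff.2 ⟨huv, hcon.1, hcon.2⟩)
  have ab := adj_iff.1 hab
  have cd := adj_iff.1 hcd
  have ac := sep a (Sym2.mem_mk_left _ _) c (Sym2.mem_mk_left _ _)
  have ad := sep a (Sym2.mem_mk_left _ _) d (Sym2.mem_mk_right _ _)
  have bc := sep b (Sym2.mem_mk_right _ _) c (Sym2.mem_mk_left _ _)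
  have bd := sep b (Sym2.mem_mk_right _ _) d (Sym2.mem_mk_right _ _)
  rcases ac with ac | ca
  · left
    have bc' : τ.Before b c := bc.resolve_right fun h => ab.2.1 (ac.trans h)
    have ad' : τ.Before a d := ad.resolve_right fun h => cd.2.2 (h.trans ac)
    exact ⟨ac, ad', bc', bd.resolve_right fun h => ab.2.1 (ad'.trans h)⟩
  · right
    have cb' : τ.Before c b := bc.resolve_left fun h => ab.2.2 (h.trans ca)
    have da' : τ.Before d a := ad.resolve_left fun h => cd.2.1 (ca.trans h)
    exact ⟨ca, da', cb', bd.resolve_left fun h => ab.2.2 (h.trans da')⟩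

/-- An induced matching with `m + 1` edges is a chain. -/
theorem exists_chainEnd (m : ℕ) : ∀ {M : Finset (Sym2 (Fin n))}, τ.graph.IsInducedMatching M →
    M.card = m + 1 → ∃ w v, s(w, v) ∈ M ∧ τ.ChainEnd (m + 1) w v := by
  induction m with
  | zero =>
    intro M hM hc
    obtain ⟨e, he⟩ := Finset.card_pos.1 (by omega : 0 < M.card)
    induction e using Sym2.inductionOn with
    | hf w v => exact ⟨w, v, he, .single (hM.1 _ he)⟩
  | succ m ih =>
    intro M hM hc
    classical
    have hU : (Finset.univ.filter fun a : Fin n => ∃ e ∈ M, a ∈ e).Nonempty := by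
      obtain ⟨e, he⟩ := Finset.card_pos.1 (by omega : 0 < M.card)
      induction e using Sym2.inductionOn with
      | hf w v => exact ⟨w, by simpa using ⟨_, he, Sym2.mem_mk_left _ _⟩⟩
    -- the last edge of the chain is the one that reaches farthest to the right on the first axis
    obtain ⟨w, hw, hmax⟩ := Finset.exists_max_image _ (fun a => (τ.trap a).x₂) hU
    obtain ⟨e, he, hwe⟩ := (Finset.mem_filter.1 hw).2
    obtain ⟨v, rfl⟩ := Sym2.mem_iff_exists.1 hwe
    have hM' : τ.graph.IsInducedMatching (M.erase s(w, v)) :=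
      ⟨fun e he => hM.1 e (Finset.mem_of_mem_erase he), fun e he f hf =>
        hM.2 e (Finset.mem_of_mem_erase he) f (Finset.mem_of_mem_erase hf)⟩
    obtain ⟨a, b, hab, hch⟩ := ih hM' (by rw [Finset.card_erase_of_mem he, hc]; rfl)
    obtain ⟨hne, hab⟩ := Finset.mem_erase.1 hab
    refine ⟨w, v, he, ?_⟩
    rcases before_or_before hM hab he hne with h | h
    · exact .snoc hch (hM.1 _ he) h.1 h.2.1 h.2.2.1 h.2.2.2
    · have h1 := h.1.1
      have h2 := hmax a (by simpa using ⟨_, hab, Sym2.mem_mk_left _ _⟩)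
      have h3 := (τ.trap a).hx
      omega

variable (τ) in
/-- The edge `p` lies entirely to the left of the edge `q`. -/
def EdgeBefore (p q : Fin n × Fin n) : Prop :=
  τ.Before p.1 q.1 ∧ τ.Before p.1 q.2 ∧ τ.Before p.2 q.1 ∧ τ.Before p.2 q.2

theorem EdgeBefore.before {p q : Fin n × Fin n} (h : τ.EdgeBefore p q) {u v : Fin n}
    (hu : u ∈ s(p.1, p.2)) (hv : v ∈ s(q.1, q.2)) : τ.Before u v := by
  obtain ⟨h1, h2, h3, h4⟩ := h
  rcases Sym2.mem_iff.1 hu with rfl | rfl <;> rcases Sym2.mem_iff.1 hv with rfl | rfl <;> assumption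

/-- A chain of edges, listed from right to left, has no repetition and is an induced matching. -/
theorem isInducedMatching_of_pairwise {l : List (Fin n × Fin n)}
    (hadj : ∀ p ∈ l, τ.graph.Adj p.1 p.2) (hl : l.Pairwise fun p q => τ.EdgeBefore q p) :
    (l.map fun p => s(p.1, p.2)).Nodup ∧
      τ.graph.IsInducedMatching (l.map fun p => s(p.1, p.2)).toFinset := by
  constructor
  · refine List.Pairwise.map _ (fun p q h heq => ?_) hl
    exact Before.irrefl _ (h.before (u := q.1) (v := q.1) (Sym2.mem_mk_left _ _)
      (heq ▸ Sym2.mem_mk_left _ _))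
  · constructor
    · intro e he
      simp only [List.mem_toFinset, List.mem_map] at he
      obtain ⟨p, hp, rfl⟩ := he
      exact hadj p hp
    · intro e₁ he₁ e₂ he₂ hne u hu v hv huv
      simp only [List.mem_toFinset, List.mem_map] at he₁ he₂
      obtain ⟨p, hp, rfl⟩ := he₁
      obtain ⟨q, hq, rfl⟩ := he₂
      have hR : ∀ p ∈ l, ∀ q ∈ l, p ≠ q → τ.EdgeBefore q p ∨ τ.EdgeBefore p q := by
        intro p hp q hq hpq
        have : Std.Symm fun p q => τ.EdgeBefore q p ∨ τ.EdgeBefore p q := ⟨fun _ _ => Or.symm⟩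
        exact (hl.imp (S := fun p q => τ.EdgeBefore q p ∨ τ.EdgeBefore p q) Or.inl).forall
          hp hq hpq
      rcases hR p hp q hq (fun h => hne (by rw [h])) with h | h
      · exact (adj_iff.1 huv).2.2 (h.before hv hu)
      · exact (adj_iff.1 huv).2.1 (h.before hu hv)

open Classical in
variable (τ) in
/-- The number of neighbours of a vertex. -/
noncomputable def deg (u : Fin n) : ℕ := (Finset.univ.filter fun w => τ.graph.Adj u w).card

theorem sum_deg : ∑ u, τ.deg u = 2 * τ.graph.edgeSet.ncard := by
  classical
  rw [← SimpleGraph.coe_edgeFinset, Set.ncard_coe_finset,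
    ← SimpleGraph.sum_degrees_eq_twice_card_edges]
  refine Finset.sum_congr rfl fun u _ => ?_
  rw [← SimpleGraph.card_neighborFinset_eq_degree, deg]
  congr 1
  ext w
  simp

end TrapezoidModel

namespace TrapezoidModel

variable {n : ℕ} (τ : TrapezoidModel n)

/-! ### The thresholds maintained by the sweep -/

/-- The number `c` encodes an edge `uo` whose left end on the first axis is that of `u`; the edge
closes a chain of `k` edges, the others being a chain recorded for `u`, and it reaches up to `d` on
the second axis. Here `R u` is the length of the chain recorded for `u`, and `V u` is the point up
to which that chain reaches on the second axis. -/
structure Link (S : Finset (Fin n)) (R V : ℕ → ℕ) (k : ℕ) (u o : Fin n) (c d : ℕ) : Prop where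
  adj : τ.graph.Adj u o
  le : (τ.trap u).x₁ ≤ (τ.trap o).x₁
  mem : u ∈ S
  rank : R u + 1 = k
  lt : V u < (τ.trap o).y₁
  code : c = u * n + o
  top : d = max (τ.trap u).y₂ (τ.trap o).y₂

/-- The data maintained by the sweep. Every edge taken into account so far reaches at most up to `b`
on the first axis. For `1 ≤ k ≤ K`, the threshold `T k` is attained by the last edge, with code
`N k`, of a chain of `k` edges. For every vertex `u ∈ S`, whose left end has been passed, `R u` is
the greatest length of a chain to the left of the left leg of `u`; one such chain reaches on the
second axis up to `V u`, which is least possible, and has a last edge with code `P u`. -/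
structure Thresholds (S : Finset (Fin n)) (b K : ℕ) (T N R V P : ℕ → ℕ) : Prop where
  zero : T 0 = 0
  mono : ∀ k < K, T k < T (k + 1)
  link : ∀ k, 1 ≤ k → k ≤ K → ∃ u o, (τ.trap u).x₂ ≤ b ∧ (τ.trap o).x₂ ≤ b ∧
    τ.Link S R V k u o (N k) (T k)
  rank_le : ∀ u ∈ S, R u ≤ K
  le : ∀ u ∈ S, T (R u) ≤ V u
  lt : ∀ u ∈ S, V u < (τ.trap u).y₁
  root : ∀ u ∈ S, R u = 0 → V u = 0
  pred : ∀ u ∈ S, 1 ≤ R u → ∃ w v, (τ.trap w).x₂ < (τ.trap u).x₁ ∧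
    (τ.trap v).x₂ < (τ.trap u).x₁ ∧ τ.Link S R V (R u) w v (P u) (V u)
  complete : ∀ u ∈ S, ∀ j w v, τ.ChainEnd j w v → τ.Before w u → τ.Before v u →
    j < R u ∨ (j = R u ∧ V u ≤ max (τ.trap w).y₂ (τ.trap v).y₂)

/-- The thresholds take into account every chain with last edge `wv`. -/
def Covered (K : ℕ) (T : ℕ → ℕ) (w v : Fin n) : Prop :=
  ∀ j, τ.ChainEnd j w v → j ≤ K ∧ T j ≤ max (τ.trap w).y₂ (τ.trap v).y₂

/-- The thresholds `(K', T')` are at least as good as `(K, T)`. -/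
def Improves (K : ℕ) (T : ℕ → ℕ) (K' : ℕ) (T' : ℕ → ℕ) : Prop :=
  K ≤ K' ∧ ∀ k ≤ K, T' k ≤ T k

variable {τ} {S : Finset (Fin n)} {b K : ℕ} {T N R V P : ℕ → ℕ}

theorem Improves.refl : Improves K T K T := ⟨le_refl _, fun _ _ => le_refl _⟩

theorem Improves.trans {K' K'' : ℕ} {T' T'' : ℕ → ℕ} (h : Improves K T K' T')
    (h' : Improves K' T' K'' T'') : Improves K T K'' T'' :=
  ⟨h.1.trans h'.1, fun k hk => (h'.2 k (hk.trans h.1)).trans (h.2 k hk)⟩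

theorem Covered.improves {K' : ℕ} {T' : ℕ → ℕ} {w v : Fin n} (h : τ.Covered K T w v)
    (h' : Improves K T K' T') : τ.Covered K' T' w v :=
  fun j hj => ⟨(h j hj).1.trans h'.1, (h'.2 j (h j hj).1).trans (h j hj).2⟩

theorem Covered.comm {w v : Fin n} (h : τ.Covered K T w v) : τ.Covered K T v w :=
  fun j hj => by rw [max_comm]; exact h j hj.comm

namespace Thresholds

theorem lt_of_lt (h : τ.Thresholds S b K T N R V P) {i j : ℕ} (hij : i < j) (hj : j ≤ K) :
    T i < T j := by
  induction j with
  | zero => omega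
  | succ j ih =>
    rcases Nat.lt_succ_iff_lt_or_eq.1 hij with h' | rfl
    · exact (ih h' (by omega)).trans (h.mono j (by omega))
    · exact h.mono i (by omega)

theorem le_of_le (h : τ.Thresholds S b K T N R V P) {i j : ℕ} (hij : i ≤ j) (hj : j ≤ K) :
    T i ≤ T j := by
  rcases hij.lt_or_eq with h' | rfl
  · exact (h.lt_of_lt h' hj).le
  · exact le_refl _

theorem le_self (h : τ.Thresholds S b K T N R V P) {k : ℕ} (hk : k ≤ K) : k ≤ T k := by
  induction k with
  | zero => omega
  | succ k ih => exact (ih (by omega)).trans_lt (h.mono k (by omega))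

theorem le_two_mul (h : τ.Thresholds S b K T N R V P) {k : ℕ} (hk : k ≤ K) : T k ≤ 2 * n := by
  rcases Nat.eq_zero_or_pos k with rfl | h0
  · rw [h.zero]; omega
  · obtain ⟨u, o, -, -, hl⟩ := h.link k h0 hk
    rw [hl.top]
    exact max_le (τ.y₂_le u) (τ.y₂_le o)

theorem length_le (h : τ.Thresholds S b K T N R V P) : K ≤ 2 * n :=
  (h.le_self (le_refl K)).trans (h.le_two_mul (le_refl K))

theorem bound_mono (h : τ.Thresholds S b K T N R V P) {b' : ℕ} (hb : b ≤ b') :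
    τ.Thresholds S b' K T N R V P :=
  { h with
    link := fun k h1 h2 =>
      let ⟨u, o, hu, ho, hl⟩ := h.link k h1 h2
      ⟨u, o, hu.trans hb, ho.trans hb, hl⟩ }

/-- The thresholds above the left leg of `u` belong to different neighbours of `u`. -/
theorem sub_le_deg (h : τ.Thresholds S b K T N R V P) {u : Fin n} {k : ℕ} (hb : b < (τ.trap u).x₁)
    (hk : ∀ i, k < i → i ≤ K → (τ.trap u).y₁ ≤ T i) : K - k ≤ τ.deg u := by
  classical
  have hinj : Set.InjOn T (Finset.Ioc k K : Finset ℕ) := by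
    intro i hi j hj hij
    simp only [Finset.coe_Ioc, Set.mem_Ioc] at hi hj
    rcases lt_trichotomy i j with hlt | heq | hlt
    · exact absurd hij (h.lt_of_lt hlt hj.2).ne
    · exact heq
    · exact absurd hij (h.lt_of_lt hlt hi.2).ne'
  have hsub : (Finset.Ioc k K).image T ⊆
      (Finset.univ.filter fun w => τ.graph.Adj u w).image fun w => (τ.trap w).y₂ := by
    intro y hy
    obtain ⟨i, hi, rfl⟩ := Finset.mem_image.1 hy
    obtain ⟨hki, hiK⟩ := Finset.mem_Ioc.1 hi
    obtain ⟨w, v, hw, hv, hl⟩ := h.link i (by omega) hiK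
    have hT := hk i hki hiK
    have key : ∀ z : Fin n, (τ.trap z).x₂ ≤ b → T i = (τ.trap z).y₂ → τ.graph.Adj u z := by
      intro z hz hTz
      have hux := (τ.trap u).hx
      refine adj_iff.2 ⟨?_, fun hB => ?_, fun hB => ?_⟩
      · rintro rfl; omega
      · have := hB.1; have := (τ.trap z).hx; omega
      · have := hB.2; omega
    rw [Finset.mem_image]
    rcases le_total (τ.trap w).y₂ (τ.trap v).y₂ with hle | hle
    · have hTv := hl.top.trans (max_eq_right hle)
      exact ⟨v, by simpa using key v hv hTv, hTv.symm⟩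
    · have hTw := hl.top.trans (max_eq_left hle)
      exact ⟨w, by simpa using key w hw hTw, hTw.symm⟩
  calc K - k = (Finset.Ioc k K).card := (Nat.card_Ioc k K).symm
    _ = ((Finset.Ioc k K).image T).card := (Finset.card_image_of_injOn hinj).symm
    _ ≤ _ := Finset.card_le_card hsub
    _ ≤ τ.deg u := Finset.card_image_le

end Thresholds

theorem Link.insert {u : Fin n} {k r x c d : ℕ} {w v : Fin n} (h : τ.Link S R V k w v c d)
    (hu : u ∉ S) : τ.Link (insert u S) (Function.update R u r) (Function.update V u x) k w v c d :=
  have hne : (w : ℕ) ≠ u := fun he => hu (Fin.ext he ▸ h.mem)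
  { h with
    mem := Finset.mem_insert_of_mem h.mem
    rank := by rw [Function.update_of_ne hne]; exact h.rank
    lt := by rw [Function.update_of_ne hne]; exact h.lt }

/-- The left leg of `u` is reached; `k` is the number of thresholds below it. -/
theorem Thresholds.start (h : τ.Thresholds S b K T N R V P) {u : Fin n} (hu : u ∉ S)
    (hb : b < (τ.trap u).x₁) {k : ℕ} (hkK : k ≤ K) (hk : T k < (τ.trap u).y₁)
    (hk' : ∀ i, k < i → i ≤ K → (τ.trap u).y₁ ≤ T i)
    (hcov : ∀ w v, (τ.trap w).x₂ < (τ.trap u).x₁ → (τ.trap v).x₂ < (τ.trap u).x₁ →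
      τ.Covered K T w v) :
    τ.Thresholds (insert u S) b K T N (Function.update R u k) (Function.update V u (T k))
      (Function.update P u (N k)) := by
  have hne : ∀ w ∈ S, (w : ℕ) ≠ u := fun w hw he => hu (Fin.ext he ▸ hw)
  refine ⟨h.zero, h.mono, ?_, ?_, ?_, ?_, ?_, ?_, ?_⟩
  · intro i h1 h2
    obtain ⟨w, v, hw, hv, hl⟩ := h.link i h1 h2
    exact ⟨w, v, hw, hv, hl.insert hu⟩
  · intro w hw
    rcases Finset.mem_insert.1 hw with rfl | hw
    · simpa using hkK
    · rw [Function.update_of_ne (hne w hw)]; exact h.rank_le w hw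
  · intro w hw
    rcases Finset.mem_insert.1 hw with rfl | hw
    · simp
    · rw [Function.update_of_ne (hne w hw), Function.update_of_ne (hne w hw)]; exact h.le w hw
  · intro w hw
    rcases Finset.mem_insert.1 hw with rfl | hw
    · simpa using hk
    · rw [Function.update_of_ne (hne w hw)]; exact h.lt w hw
  · intro w hw
    rcases Finset.mem_insert.1 hw with rfl | hw
    · simp only [Function.update_self]
      rintro rfl
      exact h.zero
    · simp only [Function.update_of_ne (hne w hw)]
      exact h.root w hw
  · intro w hw
    rcases Finset.mem_insert.1 hw with rfl | hw
    · simp only [Function.update_self]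
      intro h1
      obtain ⟨a, c, ha, hc, hl⟩ := h.link k h1 hkK
      exact ⟨a, c, ha.trans_lt hb, hc.trans_lt hb, hl.insert hu⟩
    · simp only [Function.update_of_ne (hne w hw)]
      intro h1
      obtain ⟨a, c, ha, hc, hl⟩ := h.pred w hw h1
      exact ⟨a, c, ha, hc, hl.insert hu⟩
  · intro w hw
    rcases Finset.mem_insert.1 hw with rfl | hw
    · simp only [Function.update_self]
      intro j a c hj ha hc
      obtain ⟨h1, h2⟩ := hcov a c ha.1 hc.1 j hj
      have hlt : T j < (τ.trap w).y₁ := h2.trans_lt (max_lt ha.2 hc.2)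
      have hjk : j ≤ k := by
        by_contra hcon
        exact absurd (hk' j (by omega) h1) (by omega)
      rcases hjk.lt_or_eq with hjk | rfl
      · exact .inl hjk
      · exact .inr ⟨rfl, h2⟩
    · simp only [Function.update_of_ne (hne w hw)]
      exact h.complete w hw

/-- Why an edge `uo` may be ignored when the chain recorded for `u` crosses the left leg of `o`:
that chain is as long as any chain with last edge `uo`, and it ends earlier. -/
theorem Thresholds.covered_of_le (h : τ.Thresholds S b K T N R V P) {u o : Fin n} (hu : u ∈ S)
    (hV : (τ.trap o).y₁ ≤ V u) : τ.Covered K T u o := by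
  intro j hj
  have hR : j ≤ R u := by
    cases hj with
    | single _ =>
      by_contra hcon
      have h0 : R u = 0 := by omega
      have h1 := h.root u hu h0
      have h2 := τ.one_le_y₁ o
      omega
    | snoc hc _ hau hao hbu hbo =>
      rcases h.complete u hu _ _ _ hc hau hbu with h1 | ⟨-, h1⟩
      · exact h1
      · have := max_lt hao.2 hbo.2
        omega
  have h1 := h.le_of_le hR (h.rank_le u hu)
  have h2 := h.le u hu
  have h3 := h.lt u hu
  have h4 := (τ.trap u).hy
  exact ⟨hR.trans (h.rank_le u hu), by omega⟩

/-- The length of a chain with last edge `uo` exceeds that of the chain recorded for `u` by at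
most one. -/
theorem Thresholds.le_succ (h : τ.Thresholds S b K T N R V P) {u o : Fin n} (hu : u ∈ S) {j : ℕ}
    (hj : τ.ChainEnd j u o) : j ≤ R u + 1 := by
  cases hj with
  | single _ => omega
  | snoc hc _ hau hao hbu hbo =>
    rcases h.complete u hu _ _ _ hc hau hbu with h1 | ⟨h1, -⟩ <;> omega

/-- An edge `uo` whose chain is not better than the threshold for its length changes nothing. -/
theorem Thresholds.covered_of_top (h : τ.Thresholds S b K T N R V P) {u o : Fin n} (hu : u ∈ S)
    (hK : R u + 1 ≤ K) (hT : T (R u + 1) ≤ max (τ.trap u).y₂ (τ.trap o).y₂) :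
    τ.Covered K T u o :=
  fun _ hj => ⟨(h.le_succ hu hj).trans hK, (h.le_of_le (h.le_succ hu hj) hK).trans hT⟩

/-- An edge `uo` is taken into account. -/
theorem Thresholds.update (h : τ.Thresholds S b K T N R V P) {u o : Fin n} (hu : u ∈ S)
    (hadj : τ.graph.Adj u o) (hle : (τ.trap u).x₁ ≤ (τ.trap o).x₁) (hub : (τ.trap u).x₂ ≤ b)
    (hob : (τ.trap o).x₂ ≤ b) (hV : V u < (τ.trap o).y₁) {d : ℕ}
    (hd : d = max (τ.trap u).y₂ (τ.trap o).y₂) (hlt : R u + 1 ≤ K → d < T (R u + 1)) :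
    let K' := max K (R u + 1)
    let T' := Function.update T (R u + 1) d
    τ.Thresholds S b K' T' (Function.update N (R u + 1) (u * n + o)) R V P ∧
      Improves K T K' T' ∧ τ.Covered K' T' u o := by
  intro K' T'
  have hRK := h.rank_le u hu
  have hVd : V u < d := by
    have := h.lt u hu
    have := (τ.trap u).hy
    omega
  have hT' : ∀ k ≤ K, T' k ≤ T k := by
    intro k hk
    by_cases hk' : k = R u + 1
    · subst hk'; simpa [T'] using (hlt hk).le
    · simp [T', hk']
  have hth : τ.Thresholds S b K' T' (Function.update N (R u + 1) (u * n + o)) R V P := by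
    refine ⟨?_, ?_, ?_, ?_, ?_, h.lt, h.root, h.pred, h.complete⟩
    · simp [T', h.zero]
    · intro k hk
      by_cases h1 : k = R u
      · subst h1
        have := h.le u hu
        simp only [T', Function.update_self]
        rw [Function.update_of_ne (by omega)]
        omega
      by_cases h2 : k = R u + 1
      · subst h2
        have h3 := hlt (by omega)
        have h4 := h.mono (R u + 1) (by omega)
        simp only [T', Function.update_self]
        rw [Function.update_of_ne (by omega)]
        omega
      · simp only [T']
        rw [Function.update_of_ne (by omega), Function.update_of_ne (by omega)]
        exact h.mono k (by omega)
    · intro k h1 h2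
      by_cases h3 : k = R u + 1
      · subst h3
        refine ⟨u, o, hub, hob, ⟨hadj, hle, hu, rfl, hV, by simp, by simpa [T'] using hd⟩⟩
      · simp only [T', Function.update_of_ne h3]
        exact h.link k h1 (by omega)
    · exact fun w hw => (h.rank_le w hw).trans (le_max_left _ _)
    · exact fun w hw => (hT' _ (h.rank_le w hw)).trans (h.le w hw)
  exact ⟨hth, ⟨le_max_left _ _, hT'⟩, hth.covered_of_top hu (le_max_right _ _)
    (by simp [T', hd])⟩

end TrapezoidModel

namespace TrapezoidModel

variable {n : ℕ} {τ : TrapezoidModel n}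

/-! ### Sorted arrays of trapezoids -/

/-- The cells `1, …, c` of `A` list the labels in `D`, each once, sorted by `f`; cell `0`
is empty. -/
structure Lists (A : ℕ → ℕ) (c : ℕ) (D : Finset (Fin n)) (f : Fin n → ℕ) : Prop where
  zero : A 0 = 0
  card : D.card = c
  mem : ∀ p, 1 ≤ p → p ≤ c → ∃ i ∈ D, A p = i
  surj : ∀ i ∈ D, ∃ p, 1 ≤ p ∧ p ≤ c ∧ A p = i
  inj : ∀ p q, 1 ≤ p → p ≤ c → 1 ≤ q → q ≤ c → A p = A q → p = q
  sorted : ∀ p q (i j : Fin n), 1 ≤ p → p ≤ q → q ≤ c → A p = i → A q = j → f i ≤ f j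

namespace Lists

variable {A A' : ℕ → ℕ} {c q : ℕ} {D : Finset (Fin n)} {f : Fin n → ℕ} {v : Fin n}

theorem empty (f : Fin n → ℕ) (h : A 0 = 0) : Lists A 0 ∅ f :=
  ⟨h, rfl, fun p h1 h2 => by omega, by simp, fun p q h1 h2 => by omega,
    fun p q i j h1 h2 h3 => by omega⟩

theorem le (h : Lists A c D f) : c ≤ n := by
  simpa [h.card] using Finset.card_le_univ D

/-- Insertion of `v` behind cell `q`, where the cells behind `q` have been shifted by one. -/
theorem insert (h : Lists A c D f) (hv : v ∉ D) (hq : q ≤ c)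
    (h₁ : ∀ p ≤ q, A' p = A p) (h₂ : A' (q + 1) = v)
    (h₃ : ∀ p, q < p → p ≤ c → A' (p + 1) = A p)
    (hle : ∀ p (i : Fin n), 1 ≤ p → p ≤ q → A p = i → f i ≤ f v)
    (hge : ∀ p (i : Fin n), q < p → p ≤ c → A p = i → f v ≤ f i) :
    Lists A' (c + 1) (insert v D) f := by
  have hne : ∀ p, 1 ≤ p → p ≤ c → A p ≠ v := by
    intro p h1 h2 he
    obtain ⟨i, hi, hp⟩ := h.mem p h1 h2
    exact hv (Fin.ext (hp.symm.trans he) ▸ hi)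
  -- every cell of the new array is the new cell or stems from a cell of the old one
  have old : ∀ p, 1 ≤ p → p ≤ c + 1 → (p = q + 1 ∧ A' p = v) ∨
      ∃ r, 1 ≤ r ∧ r ≤ c ∧ A' p = A r ∧ ((p ≤ q ∧ r = p) ∨ (q < r ∧ p = r + 1)) := by
    intro p h1 h2
    rcases lt_trichotomy p (q + 1) with hlt | rfl | hgt
    · exact .inr ⟨p, h1, by omega, h₁ p (by omega), .inl ⟨by omega, rfl⟩⟩
    · exact .inl ⟨rfl, h₂⟩
    · obtain ⟨r, rfl⟩ : ∃ r, p = r + 1 := ⟨p - 1, by omega⟩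
      exact .inr ⟨r, by omega, by omega, h₃ r (by omega) (by omega), .inr ⟨by omega, rfl⟩⟩
  refine ⟨(h₁ 0 (by omega)).trans h.zero, by rw [Finset.card_insert_of_notMem hv, h.card],
    ?_, ?_, ?_, ?_⟩
  · intro p h1 h2
    rcases old p h1 h2 with ⟨-, hp⟩ | ⟨r, hr1, hr2, hp, -⟩
    · exact ⟨v, Finset.mem_insert_self _ _, hp⟩
    · obtain ⟨i, hi, hri⟩ := h.mem r hr1 hr2
      exact ⟨i, Finset.mem_insert_of_mem hi, hp.trans hri⟩
  · intro i hi
    rcases Finset.mem_insert.1 hi with rfl | hi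
    · exact ⟨q + 1, by omega, by omega, h₂⟩
    · obtain ⟨p, h1, h2, hp⟩ := h.surj i hi
      rcases le_or_gt p q with hpq | hpq
      · exact ⟨p, h1, by omega, (h₁ p hpq).trans hp⟩
      · exact ⟨p + 1, by omega, by omega, (h₃ p hpq h2).trans hp⟩
  · intro p p' h1 h2 h1' h2' he
    rcases old p h1 h2 with ⟨e1, e2⟩ | ⟨r, hr1, hr2, e, hr⟩ <;>
      rcases old p' h1' h2' with ⟨e1', e2'⟩ | ⟨r', hr1', hr2', e', hr'⟩
    · omega
    · exact absurd (e'.symm.trans (he.symm.trans e2)) (hne r' hr1' hr2')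
    · exact absurd (e.symm.trans (he.trans e2')) (hne r hr1 hr2)
    · have := h.inj r r' hr1 hr2 hr1' hr2' (by rw [← e, ← e', he])
      omega
  · intro p p' i j h1 hpp h2 hi hj
    rcases old p h1 (by omega) with ⟨e1, e2⟩ | ⟨r, hr1, hr2, e, hr⟩ <;>
      rcases old p' (by omega) h2 with ⟨e1', e2'⟩ | ⟨r', hr1', hr2', e', hr'⟩
    · have h3 : i = v := Fin.ext (hi.symm.trans e2)
      have h4 : j = v := Fin.ext (hj.symm.trans e2')
      rw [h3, h4]
    · have h3 : i = v := Fin.ext (hi.symm.trans e2)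
      rw [h3]
      exact hge r' j (by omega) hr2' (e'.symm.trans hj)
    · have h4 : j = v := Fin.ext (hj.symm.trans e2')
      rw [h4]
      exact hle r i hr1 (by omega) (e.symm.trans hi)
    · exact h.sorted r r' i j hr1 (by omega) hr2' (e.symm.trans hi) (e'.symm.trans hj)

/-- The cells behind `q` list different neighbours of `v`. -/
theorem sub_le_deg (h : Lists A c D f)
    (hadj : ∀ p (i : Fin n), q < p → p ≤ c → A p = i → τ.graph.Adj v i) : c - q ≤ τ.deg v := by
  classical
  have hsub : (Finset.Ioc q c).image A ⊆
      (Finset.univ.filter fun w => τ.graph.Adj v w).image fun w : Fin n => (w : ℕ) := by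
    intro y hy
    obtain ⟨p, hp, rfl⟩ := Finset.mem_image.1 hy
    obtain ⟨h1, h2⟩ := Finset.mem_Ioc.1 hp
    obtain ⟨i, -, hi⟩ := h.mem p (by omega) h2
    exact Finset.mem_image.2 ⟨i, by simpa using hadj p i h1 h2 hi, hi.symm⟩
  have hinj : Set.InjOn A (Finset.Ioc q c : Finset ℕ) := by
    intro i hi j hj hij
    simp only [Finset.coe_Ioc, Set.mem_Ioc] at hi hj
    exact h.inj i j (by omega) hi.2 (by omega) hj.2 hij
  calc c - q = (Finset.Ioc q c).card := (Nat.card_Ioc q c).symm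
    _ = ((Finset.Ioc q c).image A).card := (Finset.card_image_of_injOn hinj).symm
    _ ≤ _ := Finset.card_le_card hsub
    _ ≤ τ.deg v := Finset.card_image_le

end Lists

variable (τ) in
/-- The four coordinates of a trapezoid, in the order `x₁, x₂, y₁, y₂` of the input. -/
def crd (o : ℕ) (i : Fin n) : ℕ :=
  match o with
  | 0 => (τ.trap i).x₁
  | 1 => (τ.trap i).x₂
  | 2 => (τ.trap i).y₁
  | _ => (τ.trap i).y₂

theorem one_le_crd (o : ℕ) (i : Fin n) : 1 ≤ τ.crd o i := by
  have h1 := τ.one_le_x₁ i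
  have h2 := τ.one_le_y₁ i
  have h3 := (τ.trap i).hx
  have h4 := (τ.trap i).hy
  unfold crd
  split <;> omega

theorem crd_le (o : ℕ) (i : Fin n) : τ.crd o i ≤ 2 * n := by
  have h1 := τ.x₂_le i
  have h2 := τ.y₂_le i
  have h3 := (τ.trap i).hx
  have h4 := (τ.trap i).hy
  unfold crd
  split <;> omega

end TrapezoidModel

namespace WordRAM

open TrapezoidModel

/-! ### The sweep invariant -/

/-- Coordinate number `o` of the trapezoid with label `e`. -/
def coord (o : ℕ) (e : Expr) : Expr := .low (4 * e + .lit o)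

@[simp] theorem eval_coord (h : Store) (o : ℕ) (e : Expr) :
    (coord o e).eval h = h.low (4 * e.eval h + o) := rfl

@[simp] theorem cost_coord (o : ℕ) (e : Expr) : (coord o e).cost = e.cost + 5 := by
  show 1 + e.cost + 1 + 1 + 1 + 1 = _
  ring

theorem ok_coord {W n : ℕ} (hW : 4 * n + 4 ≤ W) {h : Store} {o : ℕ} {e : Expr} :
    (coord o e).Ok W n h ↔ e.Ok W n h ∧ 4 * e.eval h + o < 4 * n := by
  show ((4 ≤ W ∧ e.Ok W n h ∧ 4 * e.eval h ≤ W) ∧ o ≤ W ∧ 4 * e.eval h + o ≤ W) ∧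
    4 * e.eval h + o < 4 * n ↔ _
  constructor
  · tauto
  · rintro ⟨h1, h2⟩
    exact ⟨⟨⟨by omega, h1, by omega⟩, by omega, by omega⟩, h2⟩

/-- At most the variables in `vs` and the tables in `ts` differ in the two stores. -/
def Frame (vs ts : List ℕ) (h h' : Store) : Prop :=
  h'.low = h.low ∧ (∀ r, r ∉ vs → h'.var r = h.var r) ∧ ∀ j, j ∉ ts → h'.tab j = h.tab j

theorem Frame.refl {vs ts : List ℕ} {h : Store} : Frame vs ts h h :=
  ⟨rfl, fun _ _ => rfl, fun _ _ => rfl⟩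

theorem Frame.trans {vs ts vs' ts' : List ℕ} {h h' h'' : Store} (H : Frame vs ts h h')
    (H' : Frame vs' ts' h' h'') (hv : vs ⊆ vs' := by simp) (ht : ts ⊆ ts' := by simp) :
    Frame vs' ts' h h'' :=
  ⟨H'.1.trans H.1, fun r hr => (H'.2.1 r hr).trans (H.2.1 r fun hr' => hr (hv hr')),
    fun j hj => (H'.2.2 j hj).trans (H.2.2 j fun hj' => hj (ht hj'))⟩

/-- The content of the store while the sweep line is at `b`. The left ends of the trapezoids in
`S` and the right ends of those in `D` have been passed. Variable `2` is the number of trapezoids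
in `D`, and the tables `4` and `5` list `D`, sorted by right ends on the first and on the second
axis. The number of thresholds is in variable `3`; the tables `6` and `7` contain the thresholds and
the codes of the edges that attain them, and the tables `8` to `10` the length, the extent and the
last edge of the chain recorded for each trapezoid in `S`. -/
structure Sweep {n : ℕ} (τ : TrapezoidModel n) (S D : Finset (Fin n)) (b : ℕ) (h : Store) :
    Prop where
  zero : h.var 0 = n
  low : ∀ o < 4, ∀ i : Fin n, h.low (4 * i + o) = τ.crd o i
  thr : τ.Thresholds S b (h.var 3) (h.tab 6) (h.tab 7) (h.tab 8) (h.tab 9) (h.tab 10)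
  bound : ∀ k, h.tab 6 k ≤ 2 * n
  xs : Lists (h.tab 4) (h.var 2) D (τ.crd 1)
  ys : Lists (h.tab 5) (h.var 2) D (τ.crd 3)

/-- Take the edge between the trapezoids in the variables `8` and `9` into account, the left end
of the former being the first one. Variable `10` receives the length of the chain that the edge
closes, and variable `11` the point that the edge reaches on the second axis. The summand with the
factor `2 * n + 1` makes the comparison with the threshold succeed if this length is new. -/
def relax : Prog :=
  asg 10 (.tab 8 (.var 8) + 1) ;;
  asg 11 (coord 3 (.var 8) + (coord 3 (.var 9) - coord 3 (.var 8))) ;;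
  cond (.tab 9 (.var 8)) (coord 2 (.var 9))
    (cond (.var 11) (.tab 6 (.var 10) + (.var 10 - .var 3) * (2 * .var 0 + 1))
      (stTab 6 (.var 10) (.var 11) ;;
        stTab 7 (.var 10) (.var 8 * .var 0 + .var 9) ;;
        asg 3 (.var 3 + (.var 10 - .var 3)))
      .skip)
    .skip

variable {W n : ℕ} {τ : TrapezoidModel n} {S D : Finset (Fin n)} {b : ℕ} {h : Store} {t : ℕ}

theorem Sweep.frame {h' : Store} (hs : Sweep τ S D b h) {vs ts : List ℕ} (hf : Frame vs ts h h')
    (hv : ∀ r ∈ [0, 2, 3], r ∉ vs) (ht : ∀ j ∈ [4, 5, 6, 7, 8, 9, 10], j ∉ ts) :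
    Sweep τ S D b h' := by
  obtain ⟨h1, h2, h3⟩ := hf
  simp only [List.mem_cons, List.not_mem_nil, or_false, forall_eq_or_imp, forall_eq] at hv ht
  obtain ⟨v0, v2, v3⟩ := hv
  obtain ⟨t4, t5, t6, t7, t8, t9, t10⟩ := ht
  constructor
  · rw [h2 0 v0]; exact hs.zero
  · rw [h1]; exact hs.low
  · rw [h2 3 v3, h3 6 t6, h3 7 t7, h3 8 t8, h3 9 t9, h3 10 t10]; exact hs.thr
  · rw [h3 6 t6]; exact hs.bound
  · rw [h3 4 t4, h2 2 v2]; exact hs.xs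
  · rw [h3 5 t5, h2 2 v2]; exact hs.ys

theorem wp_relax (hW : 200 * (n + 1) ≤ W) (hW' : n * n ≤ W) (hs : Sweep τ S D b h) {u o : Fin n}
    (hu : h.var 8 = u) (ho : h.var 9 = o) (huS : u ∈ S) (hadj : τ.graph.Adj u o)
    (hle : (τ.trap u).x₁ ≤ (τ.trap o).x₁) (hub : (τ.trap u).x₂ ≤ b) (hob : (τ.trap o).x₂ ≤ b) :
    wp W n relax (fun h' t' => Sweep τ S D b h' ∧
      Improves (h.var 3) (h.tab 6) (h'.var 3) (h'.tab 6) ∧ τ.Covered (h'.var 3) (h'.tab 6) u o ∧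
      Frame [3, 10, 11] [6, 7] h h' ∧ t' ≤ t + 200) h t := by
  have hun := u.isLt
  have hon := o.isLt
  have hcrd := τ.crd_le (n := n)
  have hK := hs.thr.length_le
  have hR := hs.thr.rank_le u huS
  have hRV := hs.thr.lt u huS
  have hcu : h.low (4 * u + 3) = (τ.trap u).y₂ := hs.low 3 (by norm_num) u
  have hco : h.low (4 * o + 3) = (τ.trap o).y₂ := hs.low 3 (by norm_num) o
  have hco' : h.low (4 * o + 2) = (τ.trap o).y₁ := hs.low 2 (by norm_num) o
  have b1 := τ.y₂_le u
  have b2 := τ.y₂_le o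
  have hcode : (u : ℕ) * n + o < n * n := by
    calc (u : ℕ) * n + o < u * n + n := by omega
      _ = (u + 1) * n := by ring
      _ ≤ n * n := Nat.mul_le_mul_right n hun
  have okc := @ok_coord W n (by omega)
  unfold relax
  refine wp_seq (wp_asg (by norm_num) ?_ ?_)
  · simp [hu]; omega
  refine wp_seq (wp_asg (by norm_num) ?_ ?_)
  · simp [okc, hu, ho, hcu, hco]; omega
  -- In the first case the chain recorded for `u` can be extended by the edge; then either the
  -- threshold is updated, or it is at least as good as the new chain. In the second case the edge
  -- is dispensable.
  refine wp_cond ?_ ?_ (fun hlt => ?_) (fun hlt => ?_)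
  · simp [hu]; omega
  · simp [okc, ho]; omega
  · simp [hu, ho, hco'] at hlt
    have hfac : (h.tab 8 u + 1 - h.var 3) * (2 * n + 1) ≤ 2 * n + 1 :=
      (Nat.mul_le_mul_right _ (by omega : _ ≤ 1)).trans (by omega)
    have hT := hs.bound (h.tab 8 u + 1)
    refine wp_cond ?_ ?_ (fun hlt' => ?_) (fun hlt' => ?_)
    · simp
    · simp [hu, hs.zero]; omega
    · simp [hu, ho, hs.zero, hcu, hco] at hlt'
      obtain ⟨hthr, himp, hcov⟩ := hs.thr.update huS hadj hle hub hob hlt rfl (fun hL => by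
        rw [Nat.sub_eq_zero_of_le hL, zero_mul, add_zero] at hlt'
        omega)
      have hd : (τ.trap u).y₂ + ((τ.trap o).y₂ - (τ.trap u).y₂) =
        max (τ.trap u).y₂ (τ.trap o).y₂ := by omega
      have hK' : h.var 3 + (h.tab 8 u + 1 - h.var 3) = max (h.var 3) (h.tab 8 u + 1) := by omega
      refine wp_seq (wp_stTab ?_ ?_ (by norm_num) ?_ ?_)
      · simp
      · simp
      · simp [hu]; omega
      refine wp_seq (wp_stTab ?_ ?_ (by norm_num) ?_ (wp_asg (by norm_num) ?_ ?_))
      · simp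
      · simp [hu, ho, hs.zero]; omega
      · simp [hu]; omega
      · simp [hu]; omega
      · simp [hu, ho, hs.zero, hcu, hco, hd, hK']
        refine ⟨⟨?_, ?_, ?_, ?_, ?_, ?_⟩, himp, hcov, rfl, ?_, ?_⟩
        · simpa using hs.zero
        · exact hs.low
        · simpa using hthr
        · intro k
          have := hs.bound k
          by_cases hk : k = h.tab 8 u + 1 <;> simp [hk] <;> omega
        · simpa using hs.xs
        · simpa using hs.ys
        · intro r hr
          simp at hr
          simp [hr]
        · intro j hj
          simp at hj
          simp [hj]
    · simp [hu, ho, hs.zero, hcu, hco] at hlt'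
      have hKR : h.tab 8 u + 1 ≤ h.var 3 := by
        by_contra hcon
        rw [show h.tab 8 u + 1 - h.var 3 = 1 by omega] at hlt'
        omega
      rw [Nat.sub_eq_zero_of_le hKR, zero_mul, add_zero] at hlt'
      have hf : Frame [3, 10, 11] [6, 7] h ((h.set 10 (h.tab 8 u + 1)).set 11
          ((τ.trap u).y₂ + ((τ.trap o).y₂ - (τ.trap u).y₂))) :=
        ⟨rfl, fun r hr => by simp at hr; simp [hr], fun j hj => rfl⟩
      refine wp_skip ?_
      simp [hu, ho, hcu, hco]
      exact ⟨hs.frame (vs := [10, 11]) (ts := []) ⟨rfl, fun r hr => by simp at hr; simp [hr],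
        fun _ _ => rfl⟩ (by simp) (by simp), .refl,
        hs.thr.covered_of_top huS hKR (by omega), hf⟩
  · simp [hu, ho, hco'] at hlt
    have hf : Frame [3, 10, 11] [6, 7] h ((h.set 10 (h.tab 8 u + 1)).set 11
        ((τ.trap u).y₂ + ((τ.trap o).y₂ - (τ.trap u).y₂))) :=
      ⟨rfl, fun r hr => by simp at hr; simp [hr], fun j hj => rfl⟩
    refine wp_skip ?_
    simp [hu, ho, hcu, hco]
    exact ⟨hs.frame (vs := [10, 11]) (ts := []) ⟨rfl, fun r hr => by simp at hr; simp [hr],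
      fun _ _ => rfl⟩ (by simp) (by simp), .refl,
      hs.thr.covered_of_le huS hlt, hf⟩

end WordRAM

namespace WordRAM

open TrapezoidModel

variable {W n : ℕ} {τ : TrapezoidModel n} {S D : Finset (Fin n)} {b : ℕ} {h : Store} {t : ℕ}

/-! ### The events of the sweep -/

/-- Take the edge between the trapezoids in the variables `5` and `7` into account. -/
def relaxPair : Prog :=
  cond (coord 0 (.var 7)) (coord 0 (.var 5))
    (asg 8 (.var 7) ;; asg 9 (.var 5)) (asg 8 (.var 5) ;; asg 9 (.var 7)) ;;
  relax

theorem wp_relaxPair (hW : 200 * (n + 1) ≤ W) (hW' : n * n ≤ W) (hs : Sweep τ S D b h)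
    {w v : Fin n} (hw : h.var 7 = w) (hv : h.var 5 = v) (hwS : w ∈ S) (hvS : v ∈ S)
    (hadj : τ.graph.Adj v w) (hwb : (τ.trap w).x₂ ≤ b) (hvb : (τ.trap v).x₂ ≤ b) :
    wp W n relaxPair (fun h' t' => Sweep τ S D b h' ∧
      Improves (h.var 3) (h.tab 6) (h'.var 3) (h'.tab 6) ∧ τ.Covered (h'.var 3) (h'.tab 6) w v ∧
      Frame [3, 8, 9, 10, 11] [6, 7] h h' ∧ t' ≤ t + 250) h t := by
  have hwn := w.isLt
  have hvn := v.isLt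
  have hcw : h.low (4 * w) = (τ.trap w).x₁ := hs.low 0 (by norm_num) w
  have hcv : h.low (4 * v) = (τ.trap v).x₁ := hs.low 0 (by norm_num) v
  have okc := @ok_coord W n (by omega)
  have hf : ∀ x y, Frame [8, 9] [] h ((h.set 8 x).set 9 y) := fun x y =>
    ⟨rfl, fun r hr => by simp at hr; simp [hr], fun _ _ => rfl⟩
  unfold relaxPair
  refine wp_seq (wp_cond ?_ ?_ (fun hlt => ?_) (fun hlt => ?_))
  · simp [okc, hw]
  · simp [okc, hv]
  all_goals
    simp [hw, hv, hcw, hcv] at hlt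
    refine wp_seq (wp_asg (by norm_num) (by simp) (wp_asg (by norm_num) (by simp) ?_))
  · refine wp_mono (wp_relax hW hW' (hs.frame (hf _ _) (by simp) (by simp)) (u := w) (o := v)
      (by simp [hw]) (by simp [hv]) hwS hadj.symm hlt.le hwb hvb) ?_
    rintro h' t' ⟨h1, h2, h3, h4, h5⟩
    refine ⟨h1, by simpa using h2, h3, (hf _ _).trans (h4.trans .refl), ?_⟩
    simp at h5
    omega
  · refine wp_mono (wp_relax hW hW' (hs.frame (hf _ _) (by simp) (by simp)) (u := v) (o := w)
      (by simp [hv]) (by simp [hw]) hvS hadj hlt hvb hwb) ?_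
    rintro h' t' ⟨h1, h2, h3, h4, h5⟩
    refine ⟨h1, by simpa using h2, h3.comm, (hf _ _).trans (h4.trans .refl), ?_⟩
    simp at h5
    omega

/-- Take all edges into account that join the trapezoid in variable `5` to a trapezoid whose right
end on the axis given by `o` (`0` or `2`) lies behind its left end; the array `j` contains the
candidates, sorted by these right ends. The factor `q - (q - 1)` in the test, which is `1` for
`q > 0` and `0` for `q = 0`, stops the loop at the front of the array. -/
def scan (o j : ℕ) : Prog :=
  asg 6 (.var 2) ;;
  while_ (coord o (.var 5))
    (coord (o + 1) (.tab j (.var 6)) * (.var 6 - (.var 6 - 1)) + 1)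
    (asg 7 (.tab j (.var 6)) ;; relaxPair ;; asg 6 (.var 6 - 1))

theorem wp_scan (hW : 200 * (n + 1) ≤ W) (hW' : n * n ≤ W) (hs : Sweep τ S D b h)
    {o j : ℕ} (ho : o + 1 < 4) (hj : j < 6) (hA : Lists (h.tab j) (h.var 2) D (τ.crd (o + 1)))
    {v : Fin n} (hv : h.var 5 = v) (hDS : ∀ i ∈ D, i ∈ S) (hvS : v ∈ S)
    (hDb : ∀ i ∈ D, (τ.trap i).x₂ ≤ b) (hvb : (τ.trap v).x₂ ≤ b)
    (hadj : ∀ i ∈ D, τ.crd o v ≤ τ.crd (o + 1) i → τ.graph.Adj v i) :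
    wp W n (scan o j) (fun h' t' => Sweep τ S D b h' ∧
      Improves (h.var 3) (h.tab 6) (h'.var 3) (h'.tab 6) ∧
      (∀ i ∈ D, τ.crd o v ≤ τ.crd (o + 1) i → τ.Covered (h'.var 3) (h'.tab 6) i v) ∧
      Frame [3, 6, 7, 8, 9, 10, 11] [6, 7] h h' ∧ t' ≤ t + 100 + 400 * τ.deg v) h t := by
  have hvn := v.isLt
  have okc := @ok_coord W n (by omega)
  have hcn := hA.le
  have hAlt : ∀ p ≤ h.var 2, h.tab j p < n := by
    intro p hp
    rcases Nat.eq_zero_or_pos p with rfl | h0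
    · rw [hA.zero]; omega
    · obtain ⟨i, -, hi⟩ := hA.mem p h0 hp
      rw [hi]; exact i.isLt
  have hlow : ∀ o < 4, ∀ a < n, h.low (4 * a + o) ≤ 2 * n := by
    intro o ho a ha
    rw [show a = (⟨a, ha⟩ : Fin n) from rfl, hs.low o ho]
    exact crd_le _ _
  have hlv : h.low (4 * v + o) = τ.crd o v := hs.low o (by omega) v
  have hj67 : j ∉ [6, 7] := by simp; omega
  let I : Store → ℕ → Prop := fun h' t' => Sweep τ S D b h' ∧
    Improves (h.var 3) (h.tab 6) (h'.var 3) (h'.tab 6) ∧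
    Frame [3, 6, 7, 8, 9, 10, 11] [6, 7] h h' ∧ h'.var 6 ≤ h.var 2 ∧
    (∀ p (i : Fin n), h'.var 6 < p → p ≤ h.var 2 → h.tab j p = i →
      τ.crd o v ≤ τ.crd (o + 1) i ∧ τ.Covered (h'.var 3) (h'.tab 6) i v) ∧
    t' ≤ t + 2 + 350 * (h.var 2 - h'.var 6)
  -- the number of rounds is bounded by the number of neighbours of `v`
  have hcount : ∀ h' t', I h' t' → h.var 2 - h'.var 6 ≤ τ.deg v := by
    rintro h' t' ⟨-, -, -, -, h5, -⟩
    refine hA.sub_le_deg (fun p i h1 h2 h3 => ?_)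
    obtain ⟨k, hk, hk'⟩ := hA.mem p (by omega) h2
    have hik : i = k := Fin.ext (h3.symm.trans hk')
    exact hadj i (hik ▸ hk) (h5 p i h1 h2 h3).1
  have heval : ∀ h' t', I h' t' →
      (coord o (.var 5)).eval h' = τ.crd o v ∧
      (coord (o + 1) (.tab j (.var 6)) * (.var 6 - (.var 6 - 1)) + 1 : Expr).eval h' =
        h.low (4 * h.tab j (h'.var 6) + (o + 1)) * (h'.var 6 - (h'.var 6 - 1)) + 1 := by
    rintro h' t' ⟨-, -, ⟨f1, f2, f3⟩, -, -, -⟩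
    have e5 : h'.var 5 = v := (f2 5 (by simp)).trans hv
    simp [f1, f3 j hj67, e5, hlv]
  unfold scan
  refine wp_seq (wp_asg (by norm_num) (by simp) (wp_while I (fun h' => h'.var 6) ?_ ?_ ?_ ?_))
  · have hf : Frame [3, 6, 7, 8, 9, 10, 11] [6, 7] h (h.set 6 (h.var 2)) :=
      ⟨rfl, fun r hr => by simp at hr; simp [hr], fun _ _ => rfl⟩
    refine ⟨hs.frame (vs := [6]) (ts := [])
      ⟨rfl, fun r hr => by simp at hr; simp [hr], fun _ _ => rfl⟩ (by simp) (by simp),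
      by simpa using .refl, hf, by simp, ?_, by simp⟩
    intro p i h1 h2
    simp at h1
    omega
  · rintro h' t' ⟨-, -, ⟨f1, f2, f3⟩, hq, -, -⟩
    have e5 : h'.var 5 = v := (f2 5 (by simp)).trans hv
    have hlt := hAlt _ hq
    have hle := hlow (o + 1) ho _ hlt
    have hprod : h.low (4 * h.tab j (h'.var 6) + (o + 1)) * (h'.var 6 - (h'.var 6 - 1)) ≤ 2 * n :=
      (Nat.mul_le_mul_left _ (by omega : _ ≤ 1)).trans (by omega)
    constructor
    · simp [okc, e5]; omega
    · simp [okc, f1, f3 j hj67]; omega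
  · rintro h' t' hI hlt
    obtain ⟨e1, e2⟩ := heval h' t' hI
    obtain ⟨hs', himp, hf, hq, hdone, ht⟩ := hI
    obtain ⟨f1, f2, f3⟩ := hf
    rw [e1, e2] at hlt
    have hq0 : 1 ≤ h'.var 6 := by
      by_contra hcon
      rw [show h'.var 6 - (h'.var 6 - 1) = 0 by omega] at hlt
      have := τ.one_le_crd o v
      omega
    rw [show h'.var 6 - (h'.var 6 - 1) = 1 by omega] at hlt
    obtain ⟨w, hwD, hw⟩ := hA.mem _ hq0 hq
    rw [hw, hs.low _ ho] at hlt
    have e5 : h'.var 5 = v := (f2 5 (by simp)).trans hv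
    have hwv := hadj w hwD (by omega)
    refine wp_seq (wp_asg (by norm_num) (by simp; omega) (wp_seq ?_))
    have hf7 : Frame [7] [] h' (h'.set 7 (h'.tab j (h'.var 6))) :=
      ⟨rfl, fun r hr => by simp at hr; simp [hr], fun _ _ => rfl⟩
    refine wp_mono (wp_relaxPair hW hW' (hs'.frame hf7 (by simp) (by simp)) (w := w) (v := v)
      (by simp [f3 j hj67, hw]) (by simp [e5]) (hDS w hwD) hvS hwv (hDb w hwD) hvb) ?_
    rintro h₂ t₂ ⟨s₂, i₂, c₂, fr₂, ht₂⟩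
    simp at i₂
    have g6 : h₂.var 6 = h'.var 6 := (fr₂.2.1 6 (by simp)).trans (by simp)
    have hff : Frame [3, 6, 7, 8, 9, 10, 11] [6, 7] h (h₂.set 6 (h'.var 6 - 1)) := by
      have a1 : Frame [3, 6, 7, 8, 9, 10, 11] [6, 7] h h' := ⟨f1, f2, f3⟩
      have a2 : Frame [6] [] h₂ (h₂.set 6 (h'.var 6 - 1)) :=
        ⟨rfl, fun r hr => by simp at hr; simp [hr], fun _ _ => rfl⟩
      exact a1.trans (hf7.trans (fr₂.trans (a2.trans .refl) (vs' := [3, 6, 7, 8, 9, 10, 11])))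
    refine wp_asg (by norm_num) (by simp [g6]; omega) ⟨⟨?_, ?_, ?_, ?_, ?_, ?_⟩, ?_⟩
    · exact s₂.frame (vs := [6]) (ts := [])
        ⟨rfl, fun r hr => by simp at hr; simp [hr], fun _ _ => rfl⟩ (by simp) (by simp)
    · simpa using himp.trans i₂
    · simpa [g6] using hff
    · simp [g6]; omega
    · intro p i h1 h2 h3
      simp [g6] at h1
      simp only [Store.set_var, Store.set_tab]
      rcases Nat.lt_or_ge (h'.var 6) p with h4 | h4
      · have h5 := hdone p i h4 h2 h3
        exact ⟨h5.1, by simpa using h5.2.improves i₂⟩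
      · have hp : p = h'.var 6 := by omega
        have hiw : i = w := Fin.ext (by rw [← h3, hp, hw])
        rw [hiw]
        exact ⟨by omega, by simpa using c₂⟩
    · simp at ht₂
      simp [g6]
      omega
    · simp [g6]; omega
  · rintro h' t' hI hlt
    have hc := hcount h' t' hI
    obtain ⟨e1, e2⟩ := heval h' t' hI
    obtain ⟨hs', himp, hf, hq, hdone, ht⟩ := hI
    rw [e1, e2] at hlt
    refine ⟨hs', himp, ?_, hf, ?_⟩
    · intro i hi hle
      obtain ⟨p, h1, h2, hp⟩ := hA.surj i hi
      refine (hdone p i ?_ h2 hp).2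
      by_contra hcon
      obtain ⟨w, hwD, hw⟩ := hA.mem (h'.var 6) (by omega) hq
      have h3 := hA.sorted p _ i w h1 (by omega) hq hp hw
      rw [show h'.var 6 - (h'.var 6 - 1) = 1 by omega, hw, hs.low _ ho] at hlt
      omega
    · simp
      omega

end WordRAM

namespace WordRAM

open TrapezoidModel

variable {W n : ℕ} {τ : TrapezoidModel n} {S D : Finset (Fin n)} {b : ℕ} {h : Store} {t : ℕ}

/-- Add the trapezoid in variable `5` to the two sorted arrays: at the end of the first one, and
after an insertion sort step in the second one. -/
def insertArrays : Prog :=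
  asg 6 (.var 2) ;;
  while_ (coord 3 (.var 5)) (coord 3 (.tab 5 (.var 6)) * (.var 6 - (.var 6 - 1)))
    (stTab 5 (.var 6 + 1) (.tab 5 (.var 6)) ;; asg 6 (.var 6 - 1)) ;;
  stTab 5 (.var 6 + 1) (.var 5) ;;
  asg 2 (.var 2 + 1) ;;
  stTab 4 (.var 2) (.var 5)

theorem wp_insertArrays (hW : 200 * (n + 1) ≤ W) (hs : Sweep τ S D b h)
    {v : Fin n} (hv : h.var 5 = v) (hvD : v ∉ D)
    (hDv : ∀ i ∈ D, (τ.trap i).x₂ ≤ (τ.trap v).x₂) :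
    wp W n insertArrays (fun h' t' => Sweep τ S (insert v D) b h' ∧
      Frame [2, 6] [4, 5] h h' ∧ t' ≤ t + 200 + 100 * τ.deg v) h t := by
  have hvn := v.isLt
  have okc := @ok_coord W n (by omega)
  have hA := hs.ys
  have hcn := hA.le
  have hcn' : h.var 2 < n := by
    have h1 := Finset.card_le_univ (insert v D)
    rw [Finset.card_insert_of_notMem hvD, hA.card, Fintype.card_fin] at h1
    omega
  have hAlt : ∀ p ≤ h.var 2, h.tab 5 p < n := by
    intro p hp
    rcases Nat.eq_zero_or_pos p with rfl | h0
    · rw [hA.zero]; omega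
    · obtain ⟨i, -, hi⟩ := hA.mem p h0 hp
      rw [hi]; exact i.isLt
  have hlow : ∀ a < n, h.low (4 * a + 3) ≤ 2 * n := by
    intro a ha
    rw [show a = (⟨a, ha⟩ : Fin n) from rfl, hs.low 3 (by norm_num)]
    exact crd_le _ _
  have hlv : h.low (4 * v + 3) = τ.crd 3 v := hs.low 3 (by omega) v
  let I : Store → ℕ → Prop := fun h' t' => Frame [6] [5] h h' ∧ h'.var 6 ≤ h.var 2 ∧
    (∀ p ≤ h'.var 6, h'.tab 5 p = h.tab 5 p) ∧
    (∀ p, h'.var 6 < p → p ≤ h.var 2 → h'.tab 5 (p + 1) = h.tab 5 p) ∧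
    (∀ p (i : Fin n), h'.var 6 < p → p ≤ h.var 2 → h.tab 5 p = i → τ.crd 3 v < τ.crd 3 i) ∧
    t' ≤ t + 2 + 90 * (h.var 2 - h'.var 6)
  -- the trapezoids that are moved are neighbours of `v`
  have hcount : ∀ h' t', I h' t' → h.var 2 - h'.var 6 ≤ τ.deg v := by
    rintro h' t' ⟨-, -, -, -, h5, -⟩
    refine hA.sub_le_deg (fun p i h1 h2 h3 => ?_)
    obtain ⟨k, hk, hk'⟩ := hA.mem p (by omega) h2
    have hik : i = k := Fin.ext (h3.symm.trans hk')
    have h6 : (τ.trap v).y₂ < (τ.trap i).y₂ := h5 p i h1 h2 h3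
    have h7 := (τ.trap v).hy
    have h8 := hDv i (hik ▸ hk)
    have h9 := (τ.trap i).hx
    refine adj_iff.2 ⟨?_, fun hB => ?_, fun hB => ?_⟩
    · rintro rfl; exact hvD (hik ▸ hk)
    · have := hB.1; omega
    · have := hB.2; omega
  have heval : ∀ h' t', I h' t' →
      (coord 3 (.var 5)).eval h' = τ.crd 3 v ∧
      (coord 3 (.tab 5 (.var 6)) * (.var 6 - (.var 6 - 1)) : Expr).eval h' =
        h.low (4 * h.tab 5 (h'.var 6) + 3) * (h'.var 6 - (h'.var 6 - 1)) := by
    rintro h' t' ⟨⟨f1, f2, f3⟩, -, f4, -, -, -⟩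
    have e5 : h'.var 5 = v := (f2 5 (by simp)).trans hv
    simp [f1, f4, e5, hlv]
  unfold insertArrays
  refine wp_seq (wp_asg (by norm_num) (by simp) (wp_seq (wp_while I (fun h' => h'.var 6)
    ?_ ?_ ?_ ?_)))
  · refine ⟨⟨rfl, fun r hr => by simp at hr; simp [hr], fun _ _ => rfl⟩, by simp,
      by simp, ?_, ?_, by simp⟩
    · intro p h1 h2; simp at h1; omega
    · intro p i h1 h2; simp at h1; omega
  · rintro h' t' ⟨⟨f1, f2, f3⟩, hq, f4, -, -⟩
    have e5 : h'.var 5 = v := (f2 5 (by simp)).trans hv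
    have hlt := hAlt _ hq
    have hle := hlow _ hlt
    have hprod : h.low (4 * h.tab 5 (h'.var 6) + 3) * (h'.var 6 - (h'.var 6 - 1)) ≤ 2 * n :=
      (Nat.mul_le_mul_left _ (by omega : _ ≤ 1)).trans (by omega)
    constructor
    · simp [okc, e5]; omega
    · simp [okc, f1, f4]; omega
  · rintro h' t' hI hlt
    obtain ⟨e1, e2⟩ := heval h' t' hI
    obtain ⟨⟨f1, f2, f3⟩, hq, f4, f5, f6, ht⟩ := hI
    rw [e1, e2] at hlt
    have hq0 : 1 ≤ h'.var 6 := by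
      by_contra hcon
      rw [show h'.var 6 - (h'.var 6 - 1) = 0 by omega] at hlt
      omega
    rw [show h'.var 6 - (h'.var 6 - 1) = 1 by omega] at hlt
    obtain ⟨w, hwD, hw⟩ := hA.mem _ hq0 hq
    rw [hw, hs.low _ (by norm_num)] at hlt
    refine wp_seq (wp_stTab ?_ ?_ (by norm_num) ?_ (wp_asg (by norm_num) ?_
      ⟨⟨⟨f1, ?_, ?_⟩, ?_, ?_, ?_, ?_, ?_⟩, ?_⟩))
    · simp; omega
    · simp; omega
    · simp; omega
    · simp; omega
    · intro r hr
      have := f2 r hr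
      simp at hr
      simp [hr, this]
    · intro j hj
      have := f3 j hj
      simp at hj
      simp [hj, this]
    · simp; omega
    · intro p hp
      simp at hp
      have h1 : p ≠ h'.var 6 + 1 := by omega
      simp [h1, f4 p (by omega)]
    · intro p h1 h2
      simp at h1
      rcases Nat.lt_or_ge (h'.var 6) p with h4 | h4
      · have h5 : p ≠ h'.var 6 := by omega
        simp [h5, f5 p h4 h2]
      · have h5 : p = h'.var 6 := by omega
        simp [h5, f4]
    · intro p i h1 h2 h3
      simp at h1
      rcases Nat.lt_or_ge (h'.var 6) p with h4 | h4
      · exact f6 p i h4 h2 h3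
      · have hiw : i = w := Fin.ext (by rw [← h3, show p = h'.var 6 by omega, hw])
        rw [hiw]
        omega
    · simp; omega
    · simp; omega
  · rintro h' t' hI hlt
    have hc := hcount h' t' hI
    obtain ⟨e1, e2⟩ := heval h' t' hI
    obtain ⟨⟨f1, f2, f3⟩, hq, f4, f5, f6, ht⟩ := hI
    rw [e1, e2] at hlt
    have e5 : h'.var 5 = v := (f2 5 (by simp)).trans hv
    have e2 : h'.var 2 = h.var 2 := f2 2 (by simp)
    refine wp_seq (wp_stTab ?_ ?_ (by norm_num) ?_ (wp_seq (wp_asg (by norm_num) ?_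
      (wp_stTab ?_ ?_ (by norm_num) ?_ ⟨⟨?_, ?_, ?_, ?_, ?_, ?_⟩, ⟨f1, ?_, ?_⟩, ?_⟩))))
    · simp; omega
    · simp
    · simp; omega
    · simp; omega
    · simp
    · simp
    · simp; omega
    · simpa [f2] using hs.zero
    · simpa [f1] using hs.low
    · simpa [f2, f3] using hs.thr
    · simpa [f3] using hs.bound
    · simp [e2, e5, f3]
      refine hs.xs.insert hvD (le_refl _) ?_ (by simp) (fun p h1 h2 => by omega) ?_
        (fun p i h1 h2 => by omega)
      · intro p hp
        have : p ≠ h.var 2 + 1 := by omega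
        simp [this]
      · intro p i h1 h2 h3
        obtain ⟨k, hk, hk'⟩ := hs.xs.mem p h1 h2
        have hik : i = k := Fin.ext (h3.symm.trans hk')
        exact hDv i (hik ▸ hk)
    · simp [e2, e5]
      refine hs.ys.insert hvD hq ?_ (by simp) ?_ ?_ ?_
      · intro p hp
        have : p ≠ h'.var 6 + 1 := by omega
        simp [this, f4 p hp]
      · intro p h1 h2
        have : p ≠ h'.var 6 := by omega
        simp [this, f5 p h1 h2]
      · intro p i h1 h2 h3
        obtain ⟨w, hwD, hw⟩ := hA.mem (h'.var 6) (by omega) hq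
        have h4 := hA.sorted p _ i w h1 h2 hq h3 hw
        rw [show h'.var 6 - (h'.var 6 - 1) = 1 by omega, hw, hs.low _ (by norm_num)] at hlt
        omega
      · intro p i h1 h2 h3
        exact (f6 p i h1 h2 h3).le
    · intro r hr
      simp at hr
      simp [hr, f2]
    · intro j hj
      simp at hj
      simp [hj, f3]
    · simp
      omega

/-- The right end of the trapezoid in variable `5` is reached. Its edges to trapezoids with smaller
right end are taken into account. -/
def finish : Prog := scan 0 4 ;; scan 2 5 ;; insertArrays

theorem wp_finish (hW : 200 * (n + 1) ≤ W) (hW' : n * n ≤ W) (hs : Sweep τ S D b h)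
    {v : Fin n} (hv : h.var 5 = v) (hvD : v ∉ D) (hDS : ∀ i ∈ D, i ∈ S) (hvS : v ∈ S)
    (hDv : ∀ i ∈ D, (τ.trap i).x₂ ≤ (τ.trap v).x₂) (hvb : (τ.trap v).x₂ ≤ b)
    (hcov : ∀ i ∈ D, ∀ j ∈ D, τ.Covered (h.var 3) (h.tab 6) i j) :
    wp W n finish (fun h' t' => Sweep τ S (insert v D) b h' ∧
      (∀ i ∈ insert v D, ∀ j ∈ insert v D, τ.Covered (h'.var 3) (h'.tab 6) i j) ∧
      Frame [2, 3, 6, 7, 8, 9, 10, 11] [4, 5, 6, 7] h h' ∧ t' ≤ t + 400 + 1000 * τ.deg v) h t := by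
  have hDb : ∀ i ∈ D, (τ.trap i).x₂ ≤ b := fun i hi => (hDv i hi).trans hvb
  have hvx := (τ.trap v).hx
  have hvy := (τ.trap v).hy
  have hadj : ∀ o, o = 0 ∨ o = 2 → ∀ i ∈ D, τ.crd o v ≤ τ.crd (o + 1) i → τ.graph.Adj v i := by
    intro o ho i hi hle
    refine adj_iff.2 ⟨?_, fun hB => ?_, fun hB => ?_⟩
    · rintro rfl; exact hvD hi
    · have h1 := hB.1; have h2 := (τ.trap i).hx; have h3 := hDv i hi; omega
    · have h1 := hB.1
      have h2 := hB.2
      rcases ho with rfl | rfl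
      · have : (τ.trap v).x₁ ≤ (τ.trap i).x₂ := hle
        omega
      · have : (τ.trap v).y₁ ≤ (τ.trap i).y₂ := hle
        omega
  unfold finish
  refine wp_seq (wp_mono (wp_scan hW hW' hs (o := 0) (j := 4) (by norm_num) (by norm_num) hs.xs hv
    hDS hvS hDb hvb (hadj 0 (.inl rfl))) ?_)
  rintro h₁ t₁ ⟨s₁, i₁, c₁, fr₁, ht₁⟩
  refine wp_seq (wp_mono (wp_scan hW hW' s₁ (o := 2) (j := 5) (by norm_num) (by norm_num) s₁.ys
    ((fr₁.2.1 5 (by simp)).trans hv) hDS hvS hDb hvb (hadj 2 (.inr rfl))) ?_)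
  rintro h₂ t₂ ⟨s₂, i₂, c₂, fr₂, ht₂⟩
  have fr₂' := fr₁.trans fr₂ (vs' := [3, 6, 7, 8, 9, 10, 11]) (ts' := [6, 7])
  refine wp_mono (wp_insertArrays hW s₂ ((fr₂'.2.1 5 (by simp)).trans hv) hvD hDv) ?_
  rintro h₃ t₃ ⟨s₃, fr₃, ht₃⟩
  refine ⟨s₃, ?_, fr₂'.trans (fr₃.trans .refl), by omega⟩
  rw [fr₃.2.1 3 (by simp), fr₃.2.2 6 (by simp)]
  have hiv : ∀ i ∈ D, τ.Covered (h₂.var 3) (h₂.tab 6) i v := by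
    intro i hi
    by_cases h1 : τ.crd 0 v ≤ τ.crd 1 i
    · exact (c₁ i hi h1).improves i₂
    by_cases h2 : τ.crd 2 v ≤ τ.crd 3 i
    · exact c₂ i hi h2
    · intro j hj
      exact absurd ⟨not_le.1 h1, not_le.1 h2⟩ (adj_iff.1 hj.adj).2.1
  intro i hi j hj
  rcases Finset.mem_insert.1 hi with hi | hi <;> rcases Finset.mem_insert.1 hj with hj | hj
  · intro k hk
    exact absurd (hi.trans hj.symm) (adj_iff.1 hk.adj).1
  · exact hi ▸ (hiv j hj).comm
  · exact hj ▸ hiv i hi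
  · exact (hcov i hi j hj).improves (i₁.trans i₂)

/-- The left end of the trapezoid in variable `5` is reached. Its longest chain is recorded. -/
def start : Prog :=
  asg 9 (.var 3) ;;
  while_ (coord 2 (.var 5)) (.tab 6 (.var 9) + 1) (asg 9 (.var 9 - 1)) ;;
  stTab 8 (.var 5) (.var 9) ;;
  stTab 9 (.var 5) (.tab 6 (.var 9)) ;;
  stTab 10 (.var 5) (.tab 7 (.var 9))

theorem wp_start (hW : 200 * (n + 1) ≤ W) (hs : Sweep τ S D b h)
    {u : Fin n} (hu : h.var 5 = u) (huS : u ∉ S) (hb : b < (τ.trap u).x₁)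
    (hcov : ∀ w v, (τ.trap w).x₂ < (τ.trap u).x₁ → (τ.trap v).x₂ < (τ.trap u).x₁ →
      τ.Covered (h.var 3) (h.tab 6) w v) :
    wp W n start (fun h' t' => Sweep τ (insert u S) D b h' ∧
      Frame [9] [8, 9, 10] h h' ∧ t' ≤ t + 200 + 100 * τ.deg u) h t := by
  have hun := u.isLt
  have okc := @ok_coord W n (by omega)
  have hK := hs.thr.length_le
  have hlu : h.low (4 * u + 2) = (τ.trap u).y₁ := hs.low 2 (by omega) u
  have hb6 := hs.bound
  let I : Store → ℕ → Prop := fun h' t' => Frame [9] [] h h' ∧ h'.var 9 ≤ h.var 3 ∧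
    (∀ i, h'.var 9 < i → i ≤ h.var 3 → (τ.trap u).y₁ ≤ h.tab 6 i) ∧
    t' ≤ t + 2 + 50 * (h.var 3 - h'.var 9)
  have heval : ∀ h' t', I h' t' →
      (coord 2 (.var 5)).eval h' = (τ.trap u).y₁ ∧
      (.tab 6 (.var 9) + 1 : Expr).eval h' = h.tab 6 (h'.var 9) + 1 := by
    rintro h' t' ⟨⟨f1, f2, f3⟩, -⟩
    have e5 : h'.var 5 = u := (f2 5 (by simp)).trans hu
    simp [f1, f3, e5, hlu]
  unfold start
  refine wp_seq (wp_asg (by norm_num) (by simp) (wp_seq (wp_while I (fun h' => h'.var 9)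
    ?_ ?_ ?_ ?_)))
  · refine ⟨⟨rfl, fun r hr => by simp at hr; simp [hr], fun _ _ => rfl⟩, by simp, ?_, by simp⟩
    intro p h1 h2; simp at h1; omega
  · rintro h' t' ⟨⟨f1, f2, f3⟩, hq, -, -⟩
    have e5 : h'.var 5 = u := (f2 5 (by simp)).trans hu
    have := hb6 (h'.var 9)
    constructor
    · simp [okc, e5]; omega
    · simp [f3]; omega
  · rintro h' t' hI hlt
    obtain ⟨e1, e2⟩ := heval h' t' hI
    obtain ⟨⟨f1, f2, f3⟩, hq, f4, ht⟩ := hI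
    rw [e1, e2] at hlt
    have hq0 : 1 ≤ h'.var 9 := by
      by_contra hcon
      rw [show h'.var 9 = 0 by omega, hs.thr.zero] at hlt
      have := τ.one_le_y₁ u
      omega
    refine wp_asg (by norm_num) ?_ ⟨⟨⟨f1, ?_, f3⟩, ?_, ?_, ?_⟩, ?_⟩
    · simp; omega
    · intro r hr
      have := f2 r hr
      simp at hr
      simp [hr, this]
    · simp; omega
    · intro i h1 h2
      simp at h1
      rcases Nat.lt_or_ge (h'.var 9) i with h4 | h4
      · exact f4 i h4 h2
      · rw [show i = h'.var 9 by omega]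
        omega
    · simp; omega
    · simp; omega
  · rintro h' t' hI hlt
    obtain ⟨e1, e2⟩ := heval h' t' hI
    obtain ⟨⟨f1, f2, f3⟩, hq, f4, ht⟩ := hI
    rw [e1, e2] at hlt
    have e5 : h'.var 5 = u := (f2 5 (by simp)).trans hu
    have hdeg := hs.thr.sub_le_deg hb f4
    have hthr := hs.thr.start huS hb hq (by omega) f4 hcov
    refine wp_seq (wp_stTab ?_ ?_ (by norm_num) ?_ (wp_seq (wp_stTab ?_ ?_ (by norm_num) ?_
      (wp_stTab ?_ ?_ (by norm_num) ?_ ⟨⟨?_, ?_, ?_, ?_, ?_, ?_⟩, ⟨f1, ?_, ?_⟩, ?_⟩))))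
    · simp
    · simp
    · simp [e5]; omega
    · simp
    · simp; omega
    · simp [e5]; omega
    · simp
    · simp; omega
    · simp [e5]; omega
    · simpa [f2] using hs.zero
    · simpa [f1] using hs.low
    · simpa [f2, f3, hu] using hthr
    · simpa [f3] using hs.bound
    · simpa [f2, f3] using hs.xs
    · simpa [f2, f3] using hs.ys
    · intro r hr
      have := f2 r hr
      simp at hr
      simp [this]
    · intro j hj
      simp at hj
      simp [hj, f3]
    · simp; omega

end WordRAM

namespace WordRAM

open TrapezoidModel

variable {W n : ℕ} {τ : TrapezoidModel n} {S D : Finset (Fin n)} {b : ℕ} {h : Store} {t : ℕ}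

/-! ### Bucket sort -/

/-- `p` is the head of a linked list with successor function `N` that consists of the labels in
`l`. The label `i` is represented by `i + 1`, and `0` is the end of the list. -/
def Linked (N : ℕ → ℕ) : ℕ → List (Fin n) → Prop
  | p, [] => p = 0
  | p, i :: l => p = i + 1 ∧ Linked N (N i) l

theorem Linked.congr {N N' : ℕ → ℕ} {l : List (Fin n)} (hN : ∀ i ∈ l, N' i = N i) :
    ∀ {p : ℕ}, Linked N p l → Linked N' p l := by
  induction l with
  | nil => exact fun h => h
  | cons i l ih =>
    intro p hp
    refine ⟨hp.1, ?_⟩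
    rw [hN i List.mem_cons_self]
    exact ih (fun k hk => hN k (List.mem_cons_of_mem _ hk)) hp.2

/-- For each `x`, the list with head `H x` consists of the labels whose coordinate number `o`
is `x`. -/
def Buckets (τ : TrapezoidModel n) (o : ℕ) (H N : ℕ → ℕ) : Prop :=
  ∀ x, ∃ l : List (Fin n), Linked N (H x) l ∧ l.Nodup ∧ ∀ i, i ∈ l ↔ τ.crd o i = x

/-- Distribute the labels to buckets according to coordinate number `o`; the heads of the lists
are stored in table `j`, the successors in table `k`. -/
def bucket (o j k : ℕ) : Prog :=
  asg 5 0 ;;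
  while_ (.var 5) (.var 0)
    (stTab k (.var 5) (.tab j (coord o (.var 5))) ;;
      stTab j (coord o (.var 5)) (.var 5 + 1) ;;
      asg 5 (.var 5 + 1))

theorem wp_bucket (hW : 200 * (n + 1) ≤ W) {o j k : ℕ} (ho : o < 4) (hj : j < 16) (hk : k < 16)
    (hjk : j ≠ k) (h0 : h.var 0 = n) (hlow : ∀ o < 4, ∀ i : Fin n, h.low (4 * i + o) = τ.crd o i)
    (hH : ∀ x, h.tab j x = 0) :
    wp W n (bucket o j k) (fun h' t' => Buckets τ o (h'.tab j) (h'.tab k) ∧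
      Frame [5] [j, k] h h' ∧ t' ≤ t + 100 + 100 * n) h t := by
  have okc := @ok_coord W n (by omega)
  let I : Store → ℕ → Prop := fun h' t' => Frame [5] [j, k] h h' ∧ h'.var 5 ≤ n ∧
    (∀ x, ∃ l : List (Fin n), Linked (h'.tab k) (h'.tab j x) l ∧ l.Nodup ∧
      ∀ i, i ∈ l ↔ τ.crd o i = x ∧ (i : ℕ) < h'.var 5) ∧
    t' ≤ t + 2 + 80 * h'.var 5
  unfold bucket
  refine wp_seq (wp_asg (by norm_num) (by simp) (wp_while I (fun h' => n - h'.var 5) ?_ ?_ ?_ ?_))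
  · refine ⟨⟨rfl, fun r hr => by simp at hr; simp [hr], fun _ _ => rfl⟩, by simp,
      fun x => ⟨[], ?_, by simp, by simp⟩, by simp⟩
    simpa [Linked] using hH x
  · intro h' t' _
    simp
  · rintro h' t' ⟨⟨f1, f2, f3⟩, hle, hl, ht⟩ hlt
    simp [f2, h0] at hlt
    obtain ⟨v, hv⟩ : ∃ v : Fin n, h'.var 5 = v := ⟨⟨h'.var 5, hlt⟩, rfl⟩
    have hlv : h'.low (4 * v + o) = τ.crd o v := by rw [f1]; exact hlow o ho v
    have hcle := τ.crd_le o v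
    have hvn := v.isLt
    refine wp_seq (wp_stTab ?_ ?_ hk ?_ (wp_seq (wp_stTab ?_ ?_ hj ?_ (wp_asg (by norm_num) ?_
      ⟨⟨⟨f1, ?_, ?_⟩, ?_, ?_, ?_⟩, ?_⟩))))
    · simp
    · simp [okc, hv, hlv, hj]; omega
    · simp [hv]; omega
    · simp [okc, hv]; omega
    · simp [hv]; omega
    · simp [hv, hlv]; omega
    · simp [hv]; omega
    · intro r hr
      have := f2 r hr
      simp at hr
      simp [hr, this]
    · intro i hi
      have := f3 i hi
      simp at hi
      simp [hi, this]
    · simp [hv]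
    · intro x
      obtain ⟨l, hl1, hl2, hl3⟩ := hl x
      have hvl : ∀ x l, Linked (h'.tab k) (h'.tab j x) l →
          (∀ i, i ∈ l ↔ τ.crd o i = x ∧ (i : ℕ) < h'.var 5) →
          Linked (Function.update (h'.tab k) v (h'.tab j (τ.crd o v))) (h'.tab j x) l := by
        intro x l hl1 hl3
        refine hl1.congr fun i hi => ?_
        have : (i : ℕ) ≠ v := by have := ((hl3 i).1 hi).2; omega
        simp [this]
      by_cases hx : x = τ.crd o v
      · refine ⟨v :: l, ?_, ?_, ?_⟩
        · have := hvl x l hl1 hl3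
          rw [hx] at this
          simpa [Linked, hv, hlv, hx, hjk, hjk.symm] using this
        · refine List.nodup_cons.2 ⟨fun hvm => ?_, hl2⟩
          have := ((hl3 v).1 hvm).2
          omega
        · intro i
          rw [List.mem_cons, hl3]
          simp only [Store.set_var, if_true]
          rw [hx]
          constructor
          · rintro (rfl | ⟨h1, h2⟩)
            · exact ⟨rfl, by simp [hv]⟩
            · exact ⟨h1, by simp; omega⟩
          · rintro ⟨h1, h2⟩
            simp at h2
            rcases Nat.lt_or_ge (i : ℕ) (h'.var 5) with h3 | h3
            · exact .inr ⟨h1, h3⟩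
            · exact .inl (Fin.ext (by omega))
      · refine ⟨l, ?_, hl2, ?_⟩
        · simpa [hv, hlv, hx, hjk, hjk.symm] using hvl x l hl1 hl3
        · intro i
          rw [hl3]
          simp
          intro h1
          have : (i : ℕ) ≠ v := fun he => hx (by rw [← h1, Fin.ext he])
          omega
    · simp; omega
    · simp; omega
  · rintro h' t' ⟨⟨f1, f2, f3⟩, hle, hl, ht⟩ hlt
    simp [f2, h0] at hlt
    refine ⟨fun x => ?_, ⟨f1, f2, f3⟩, ?_⟩
    · obtain ⟨l, hl1, hl2, hl3⟩ := hl x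
      refine ⟨l, hl1, hl2, fun i => ?_⟩
      rw [hl3]
      have := i.isLt
      exact ⟨And.left, fun h1 => ⟨h1, by omega⟩⟩
    · simp; omega

/-- Run `p` for every label in the bucket of variable `1`; the label is passed in variable `5`. -/
def forBucket (j k : ℕ) (p : Prog) : Prog :=
  asg 4 (.tab j (.var 1)) ;;
  while_ 0 (.var 4) (asg 5 (.var 4 - 1) ;; p ;; asg 4 (.tab k (.var 5)))

/-- The rule for a traversal of a bucket: `I l` is an invariant that holds when the labels in `l`
remain to be treated. -/
theorem wp_forBucket (hW : 200 * (n + 1) ≤ W) {j k : ℕ} (hj : j < 16) (hk : k < 16) {p : Prog}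
    {Q : Store → ℕ → Prop} (I : List (Fin n) → Store → ℕ → Prop) {l : List (Fin n)}
    (hl : Linked (h.tab k) (h.tab j (h.var 1)) l) (hx : h.var 1 ≤ 2 * n + 1)
    (hset : ∀ l h t r x, r = 4 ∨ r = 5 → I l h t → I l (h.set r x) t)
    (h0 : I l h (t + 10))
    (hbody : ∀ (i : Fin n) rest h' t', I (i :: rest) h' t' → h'.var 5 = i → h'.tab k = h.tab k →
      wp W n p (fun h'' t'' => I rest h'' (t'' + 10) ∧ h''.var 5 = i ∧ h''.tab k = h.tab k) h'
        (t' + 7))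
    (hexit : ∀ h' t', I [] h' t' → Q h' (t' + 3)) :
    wp W n (forBucket j k p) Q h t := by
  -- the length of the remaining list is the variant; it is determined by the head
  classical
  let J : List (Fin n) → Store → ℕ → Prop := fun l h' t' =>
    I l h' t' ∧ h'.tab k = h.tab k ∧ Linked (h.tab k) (h'.var 4) l
  have huniq : ∀ (l l' : List (Fin n)) q, Linked (h.tab k) q l → Linked (h.tab k) q l' →
      l = l' := by
    intro l
    induction l with
    | nil =>
      intro l' q h1 h2
      cases l' with
      | nil => rfl
      | cons i l' => have e1 : q = 0 := h1; have e2 := h2.1; omega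
    | cons i l ih =>
      intro l' q h1 h2
      cases l' with
      | nil => have e1 : q = 0 := h2; have e2 := h1.1; omega
      | cons i' l' =>
        have hii : i = i' := Fin.ext (by have e1 := h1.1; have e2 := h2.1; omega)
        subst hii
        rw [ih l' _ h1.2 h2.2]
  let μ : Store → ℕ := fun h' =>
    if H : ∃ l : List (Fin n), Linked (h.tab k) (h'.var 4) l then H.choose.length else 0
  have hμ : ∀ h' (l : List (Fin n)), Linked (h.tab k) (h'.var 4) l → μ h' = l.length := by
    intro h' l hl
    have H : ∃ l : List (Fin n), Linked (h.tab k) (h'.var 4) l := ⟨l, hl⟩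
    simp only [μ, dif_pos H]
    rw [huniq _ _ _ H.choose_spec hl]
  unfold forBucket
  refine wp_seq (wp_asg (by norm_num) ?_ (wp_while (fun h' t' => ∃ l, J l h' t') μ ?_ ?_ ?_ ?_))
  · simp [hj]; omega
  · exact ⟨l, hset _ _ _ _ _ (.inl rfl) (by simpa using h0), rfl, by simpa using hl⟩
  · rintro h' t' -
    simp
  · rintro h' t' ⟨l, hI, hN, hL⟩ hlt
    simp at hlt
    cases l with
    | nil => exact absurd hL (by simp [Linked]; omega)
    | cons i rest =>
      have h4 : h'.var 4 = i + 1 := hL.1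
      have hin := i.isLt
      refine wp_seq (wp_asg (by norm_num) (by simp [h4]; omega) (wp_seq (wp_mono
        (hbody i rest (h'.set 5 i) t' (hset _ _ _ _ _ (.inr rfl) hI) (by simp) (by simpa using hN))
        ?_) |> fun H => by simpa [h4] using H))
      rintro h₂ t₂ ⟨hI₂, h5, hN₂⟩
      refine wp_asg (by norm_num) ?_ ⟨⟨rest, hset _ _ _ _ _ (.inl rfl) (by simpa using hI₂),
        by simpa using hN₂, by simpa [h5, hN₂] using hL.2⟩, ?_⟩
      · simp [hk, h5]; omega
      · rw [hμ _ (i :: rest) hL, hμ _ rest (by simpa [h5, hN₂] using hL.2)]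
        simp
  · rintro h' t' ⟨l, hI, hN, hL⟩ hlt
    simp at hlt
    cases l with
    | nil => simpa using hexit h' t' hI
    | cons i rest =>
      have h4 : h'.var 4 = i + 1 := hL.1
      omega

end WordRAM

namespace WordRAM

open TrapezoidModel

variable {W n : ℕ} {τ : TrapezoidModel n} {S D : Finset (Fin n)} {b : ℕ} {h : Store} {t : ℕ}

/-! ### The sweep -/

/-- The number of steps paid for the left ends in `S` and the right ends in `D`. -/
noncomputable def paid (τ : TrapezoidModel n) (S D : Finset (Fin n)) : ℕ :=
  ∑ i ∈ S, (500 + 1000 * τ.deg i) + ∑ i ∈ D, (500 + 1000 * τ.deg i)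

theorem paid_insert_left {u : Fin n} (hu : u ∉ S) :
    paid τ (insert u S) D = paid τ S D + (500 + 1000 * τ.deg u) := by
  rw [paid, paid, Finset.sum_insert hu]; ring

theorem paid_insert_right {u : Fin n} (hu : u ∉ D) :
    paid τ S (insert u D) = paid τ S D + (500 + 1000 * τ.deg u) := by
  rw [paid, paid, Finset.sum_insert hu]; ring

/-- The invariant of the sweep before the events at `x` are treated. The tables `0` to `3` contain
the buckets of left ends and of right ends. -/
structure SweepAt (τ : TrapezoidModel n) (x : ℕ) (S D : Finset (Fin n)) (h : Store) : Prop where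
  pos : 1 ≤ x
  le : x ≤ 2 * n + 1
  var : h.var 1 = x
  sweep : Sweep τ S D (x - 1) h
  mem_left : ∀ i, i ∈ S ↔ (τ.trap i).x₁ < x
  mem_right : ∀ i, i ∈ D ↔ (τ.trap i).x₂ < x
  covered : ∀ i ∈ D, ∀ j ∈ D, τ.Covered (h.var 3) (h.tab 6) i j
  lefts : Buckets τ 0 (h.tab 0) (h.tab 1)
  rights : Buckets τ 1 (h.tab 2) (h.tab 3)

/-- All left ends at `x` are treated. -/
theorem wp_lefts (hW : 200 * (n + 1) ≤ W) {x : ℕ} (hs : SweepAt τ x S D h) :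
    wp W n (forBucket 0 1 start) (fun h' t' => ∃ S', Sweep τ S' D (x - 1) h' ∧
      (∀ i, i ∈ S' ↔ (τ.trap i).x₁ ≤ x) ∧ Frame [4, 5, 9] [8, 9, 10] h h' ∧
      t' + paid τ S D ≤ t + 13 + paid τ S' D) h t := by
  have hx := hs.le
  have hx1 := hs.pos
  obtain ⟨l, hl1, hl2, hl3⟩ := hs.lefts x
  refine wp_forBucket hW (by norm_num) (by norm_num) (l := l)
    (fun rest h' t' => ∃ S', Sweep τ S' D (x - 1) h' ∧ Frame [4, 5, 9] [8, 9, 10] h h' ∧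
      rest.Nodup ∧ (∀ i ∈ rest, i ∉ S' ∧ (τ.trap i).x₁ = x) ∧
      (∀ i, (i ∈ S' ∨ i ∈ rest) ↔ (τ.trap i).x₁ ≤ x) ∧
      t' + paid τ S D ≤ t + 10 + paid τ S' D) (by rw [hs.var]; exact hl1)
    (by rw [hs.var]; exact hx) ?_ ?_ ?_ ?_
  · rintro l h' t' r y hr ⟨S', s', fr', hr'⟩
    have hf : Frame [4, 5] [] h' (h'.set r y) :=
      ⟨rfl, fun r' hr' => by
        have : r' ≠ r := by rintro rfl; simp at hr'; omega
        simp [this], fun _ _ => rfl⟩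
    exact ⟨S', s'.frame hf (by simp) (by simp), fr'.trans (hf.trans .refl), hr'⟩
  · refine ⟨S, hs.sweep, .refl, hl2, fun i hi => ?_, fun i => ?_, by omega⟩
    · have h1 : (τ.trap i).x₁ = x := (hl3 i).1 hi
      rw [hs.mem_left]
      exact ⟨by omega, h1⟩
    · have h1 : i ∈ l ↔ (τ.trap i).x₁ = x := hl3 i
      rw [hs.mem_left, h1]
      omega
  · rintro i rest h' t' ⟨S', s', fr', hnd, hrest, hS', ht'⟩ h5 hN
    obtain ⟨hiS, hix⟩ := hrest i List.mem_cons_self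
    obtain ⟨hir, hnd⟩ := List.nodup_cons.1 hnd
    refine wp_mono (wp_start hW s' h5 hiS (by omega) ?_) ?_
    · intro w v hw hv
      rw [fr'.2.1 3 (by simp), fr'.2.2 6 (by simp)]
      exact hs.covered w ((hs.mem_right w).2 (by omega)) v ((hs.mem_right v).2 (by omega))
    · rintro h₂ t₂ ⟨s₂, fr₂, ht₂⟩
      refine ⟨⟨insert i S', s₂, fr'.trans (fr₂.trans .refl), hnd, ?_, ?_, ?_⟩, ?_, ?_⟩
      · intro k hk
        obtain ⟨h1, h2⟩ := hrest k (List.mem_cons_of_mem _ hk)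
        refine ⟨fun hmem => ?_, h2⟩
        rcases Finset.mem_insert.1 hmem with rfl | hmem
        · exact hir hk
        · exact h1 hmem
      · intro k
        rw [← hS', Finset.mem_insert, List.mem_cons]
        tauto
      · rw [paid_insert_left hiS]
        omega
      · rw [fr₂.2.1 5 (by simp), h5]
      · rw [fr₂.2.2 1 (by simp), hN]
  · rintro h' t' ⟨S', s', fr', -, -, hS', ht'⟩
    exact ⟨S', s', by simpa using hS', fr', by omega⟩

/-- All right ends at `x` are treated, after the left ends at `x`. -/
theorem wp_rights (hW : 200 * (n + 1) ≤ W) (hW' : n * n ≤ W) {x : ℕ} (hx : x ≤ 2 * n)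
    (hs : Sweep τ S D x h) (h1 : h.var 1 = x)
    (hS : ∀ i, i ∈ S ↔ (τ.trap i).x₁ ≤ x) (hD : ∀ i, i ∈ D ↔ (τ.trap i).x₂ < x)
    (hcov : ∀ i ∈ D, ∀ j ∈ D, τ.Covered (h.var 3) (h.tab 6) i j)
    (hb : Buckets τ 1 (h.tab 2) (h.tab 3)) :
    wp W n (forBucket 2 3 finish) (fun h' t' => ∃ D', Sweep τ S D' x h' ∧
      (∀ i, i ∈ D' ↔ (τ.trap i).x₂ ≤ x) ∧
      (∀ i ∈ D', ∀ j ∈ D', τ.Covered (h'.var 3) (h'.tab 6) i j) ∧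
      Frame [2, 3, 4, 5, 6, 7, 8, 9, 10, 11] [4, 5, 6, 7] h h' ∧
      t' + paid τ S D ≤ t + 13 + paid τ S D') h t := by
  obtain ⟨l, hl1, hl2, hl3⟩ := hb x
  refine wp_forBucket hW (by norm_num) (by norm_num) (l := l)
    (fun rest h' t' => ∃ D', Sweep τ S D' x h' ∧
      Frame [2, 3, 4, 5, 6, 7, 8, 9, 10, 11] [4, 5, 6, 7] h h' ∧
      rest.Nodup ∧ (∀ i ∈ rest, i ∉ D' ∧ (τ.trap i).x₂ = x) ∧
      (∀ i, (i ∈ D' ∨ i ∈ rest) ↔ (τ.trap i).x₂ ≤ x) ∧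
      (∀ i ∈ D', ∀ j ∈ D', τ.Covered (h'.var 3) (h'.tab 6) i j) ∧
      t' + paid τ S D ≤ t + 10 + paid τ S D') (by rw [h1]; exact hl1)
    (by omega) ?_ ?_ ?_ ?_
  · rintro l h' t' r y hr ⟨D', s', fr', a1, a2, a3, a4, a5⟩
    have hf : Frame [4, 5] [] h' (h'.set r y) :=
      ⟨rfl, fun r' hr' => by
        have : r' ≠ r := by rintro rfl; simp at hr'; omega
        simp [this], fun _ _ => rfl⟩
    refine ⟨D', s'.frame hf (by simp) (by simp), fr'.trans (hf.trans .refl), a1, a2, a3, ?_, a5⟩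
    rwa [hf.2.1 3 (by simp), hf.2.2 6 (by simp)]
  · refine ⟨D, hs, .refl, hl2, fun i hi => ?_, fun i => ?_, hcov, by omega⟩
    · have h1 : (τ.trap i).x₂ = x := (hl3 i).1 hi
      rw [hD]
      exact ⟨by omega, h1⟩
    · have h1 : i ∈ l ↔ (τ.trap i).x₂ = x := hl3 i
      rw [hD, h1]
      omega
  · rintro i rest h' t' ⟨D', s', fr', hnd, hrest, hD', hcov', ht'⟩ h5 hN
    obtain ⟨hiD, hix⟩ := hrest i List.mem_cons_self
    obtain ⟨hir, hnd⟩ := List.nodup_cons.1 hnd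
    have hle : ∀ k ∈ D', (τ.trap k).x₂ ≤ x := fun k hk => (hD' k).1 (.inl hk)
    refine wp_mono (wp_finish hW hW' s' h5 hiD (fun k hk => ?_) ?_ (fun k hk => ?_) ?_ hcov') ?_
    · have := hle k hk
      have := (τ.trap k).hx
      exact (hS k).2 (by omega)
    · have := (τ.trap i).hx
      exact (hS i).2 (by omega)
    · rw [hix]; exact hle k hk
    · omega
    · rintro h₂ t₂ ⟨s₂, c₂, fr₂, ht₂⟩
      refine ⟨⟨insert i D', s₂, fr'.trans (fr₂.trans .refl), hnd, ?_, ?_, c₂, ?_⟩, ?_, ?_⟩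
      · intro k hk
        obtain ⟨h1, h2⟩ := hrest k (List.mem_cons_of_mem _ hk)
        refine ⟨fun hmem => ?_, h2⟩
        rcases Finset.mem_insert.1 hmem with rfl | hmem
        · exact hir hk
        · exact h1 hmem
      · intro k
        rw [← hD', Finset.mem_insert, List.mem_cons]
        tauto
      · rw [paid_insert_right hiD]
        omega
      · rw [fr₂.2.1 5 (by simp), h5]
      · rw [fr₂.2.2 3 (by simp), hN]
  · rintro h' t' ⟨D', s', fr', -, -, hD', hcov', ht'⟩
    exact ⟨D', s', by simpa using hD', hcov', fr', by omega⟩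

/-- The sweep over all events on the first axis. -/
def sweep : Prog :=
  asg 1 1 ;;
  while_ (.var 1) (2 * .var 0 + 1)
    (forBucket 0 1 start ;; forBucket 2 3 finish ;; asg 1 (.var 1 + 1))

theorem wp_sweep (hW : 200 * (n + 1) ≤ W) (hW' : n * n ≤ W) (hs : SweepAt τ 1 ∅ ∅ (h.set 1 1)) :
    wp W n sweep (fun h' t' => ∃ S D, SweepAt τ (2 * n + 1) S D h' ∧
      t' ≤ t + 100 * (n + 1) + paid τ S D) h t := by
  unfold sweep
  refine wp_seq (wp_asg (by norm_num) (by simp; omega) (wp_while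
    (fun h' t' => ∃ x S D, SweepAt τ x S D h' ∧ t' ≤ t + 2 + 40 * (x - 1) + paid τ S D)
    (fun h' => 2 * n + 1 - h'.var 1) ?_ ?_ ?_ ?_))
  · exact ⟨1, ∅, ∅, by simpa using hs, by simp⟩
  · rintro h' t' ⟨x, S, D, hs, -⟩
    have := hs.le
    have := hs.sweep.zero
    simp [hs.sweep.zero]; omega
  · rintro h' t' ⟨x, S, D, hs, ht⟩ hlt
    have hx1 := hs.pos
    simp [hs.var, hs.sweep.zero] at hlt
    refine wp_seq (wp_mono (wp_lefts hW hs) ?_)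
    rintro h₁ t₁ ⟨S₁, s₁, hS₁, fr₁, ht₁⟩
    have hs₁ : Sweep τ S₁ D x h₁ := { s₁ with thr := s₁.thr.bound_mono (by omega) }
    refine wp_seq (wp_mono (wp_rights hW hW' (by omega) hs₁ ((fr₁.2.1 1 (by simp)).trans hs.var)
      hS₁ hs.mem_right ?_ ?_) ?_)
    · rw [fr₁.2.1 3 (by simp), fr₁.2.2 6 (by simp)]; exact hs.covered
    · rw [fr₁.2.2 2 (by simp), fr₁.2.2 3 (by simp)]; exact hs.rights
    rintro h₂ t₂ ⟨D₂, s₂, hD₂, c₂, fr₂, ht₂⟩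
    have e1 : h₂.var 1 = x := (fr₂.2.1 1 (by simp)).trans ((fr₁.2.1 1 (by simp)).trans hs.var)
    refine wp_asg (by norm_num) (by simp [e1]; omega) ⟨⟨x + 1, S₁, D₂, ⟨by omega, by omega, by
      simp [e1], ?_, ?_, ?_, by simpa using c₂, ?_, ?_⟩, ?_⟩, ?_⟩
    · exact s₂.frame (vs := [1]) (ts := [])
        ⟨rfl, fun r hr => by simp at hr; simp [hr], fun _ _ => rfl⟩ (by simp) (by simp)
    · intro i; rw [hS₁]; omega
    · intro i; rw [hD₂]; omega
    · simpa [fr₂.2.2, fr₁.2.2] using hs.lefts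
    · simpa [fr₂.2.2, fr₁.2.2] using hs.rights
    · simp at ht₁ ⊢
      omega
    · simp [e1, hs.var]; omega
  · rintro h' t' ⟨x, S, D, hs, ht⟩ hlt
    have hle := hs.le
    simp [hs.var, hs.sweep.zero] at hlt
    obtain rfl : x = 2 * n + 1 := by omega
    exact ⟨S, D, hs, by simp; omega⟩

end WordRAM

namespace TrapezoidModel

variable {n : ℕ} {τ : TrapezoidModel n}

/-! ### Reading off an optimal chain -/

/-- `l` is the beginning of the list of edges that is obtained by starting with the code `c` and
passing from an edge `uo` to the edge with code `P u`. -/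
def Follows (P : ℕ → ℕ) : ℕ → List (Fin n × Fin n) → Prop
  | _, [] => True
  | c, p :: l => c = p.1 * n + p.2 ∧ Follows P (P p.1) l

theorem EdgeBefore.trans {p q r : Fin n × Fin n} (h : τ.EdgeBefore p q) (h' : τ.EdgeBefore q r) :
    τ.EdgeBefore p r :=
  ⟨h.1.trans h'.1, h.1.trans h'.2.1, h.2.2.1.trans h'.1, h.2.2.1.trans h'.2.1⟩

variable {S : Finset (Fin n)} {b K : ℕ} {T N R V P : ℕ → ℕ}

theorem Thresholds.exists_list (h : τ.Thresholds S b K T N R V P) (k : ℕ) :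
    ∀ {u o : Fin n} {c d : ℕ}, τ.Link S R V (k + 1) u o c d →
      ∃ l : List (Fin n × Fin n), l.length = k ∧ Follows P c ((u, o) :: l) ∧
        (∀ p ∈ (u, o) :: l, τ.graph.Adj p.1 p.2) ∧
        ((u, o) :: l).Pairwise fun p q => τ.EdgeBefore q p := by
  induction k with
  | zero =>
    intro u o c d hl
    exact ⟨[], rfl, ⟨hl.code, trivial⟩, by simpa using hl.adj, List.pairwise_singleton _ _⟩
  | succ k ih =>
    intro u o c d hl
    have hR : R u = k + 1 := by have := hl.rank; omega
    obtain ⟨w, v, hw, hv, hl'⟩ := h.pred u hl.mem (by omega)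
    rw [hR] at hl'
    obtain ⟨l, h1, h2, h3, h4⟩ := ih hl'
    have hwv : τ.EdgeBefore (w, v) (u, o) := by
      have e1 := hl.le
      have e2 := hl.lt
      have e3 := h.lt u hl.mem
      have e4 := hl'.top
      refine ⟨⟨?_, ?_⟩, ⟨?_, ?_⟩, ⟨?_, ?_⟩, ⟨?_, ?_⟩⟩ <;> dsimp only <;> omega
    refine ⟨(w, v) :: l, by simp [h1], ⟨hl.code, h2⟩, ?_, List.pairwise_cons.2 ⟨?_, h4⟩⟩
    · intro p hp
      rcases List.mem_cons.1 hp with rfl | hp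
      · exact hl.adj
      · exact h3 p hp
    · intro q hq
      rcases List.mem_cons.1 hq with rfl | hq
      · exact hwv
      · exact ((List.pairwise_cons.1 h4).1 q hq).trans hwv

/-- When all edges have been taken into account, the chain that belongs to the last threshold is a
maximum induced matching. -/
theorem Thresholds.exists_maximum (h : τ.Thresholds S b K T N R V P)
    (hcov : ∀ w v, τ.Covered K T w v) :
    ∃ l : List (Fin n × Fin n), l.length = K ∧ Follows P (N K) l ∧
      (l.map fun p => s(p.1, p.2)).Nodup ∧
      τ.graph.IsMaximumInducedMatching (l.map fun p => s(p.1, p.2)).toFinset := by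
  obtain ⟨l, h1, h2, h3, h4⟩ : ∃ l : List (Fin n × Fin n), l.length = K ∧ Follows P (N K) l ∧
      (∀ p ∈ l, τ.graph.Adj p.1 p.2) ∧ l.Pairwise fun p q => τ.EdgeBefore q p := by
    rcases K with _ | k
    · exact ⟨[], rfl, trivial, by simp, List.Pairwise.nil⟩
    · obtain ⟨u, o, -, -, hl⟩ := h.link (k + 1) (by omega) (le_refl _)
      obtain ⟨l, h1, h2⟩ := h.exists_list k hl
      exact ⟨(u, o) :: l, by simp [h1], h2⟩
  obtain ⟨h5, h6⟩ := isInducedMatching_of_pairwise h3 h4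
  refine ⟨l, h1, h2, h5, h6, fun M' hM' => ?_⟩
  rw [List.toFinset_card_of_nodup h5, List.length_map, h1]
  rcases hc : M'.card with _ | m
  · exact Nat.zero_le _
  · obtain ⟨w, v, -, hch⟩ := exists_chainEnd m hM' hc
    exact (hcov w v _ hch).1

end TrapezoidModel

namespace WordRAM

open TrapezoidModel

variable {W n : ℕ} {τ : TrapezoidModel n} {h : Store} {t : ℕ}

/-- Write the edges of an optimal chain to the beginning of the memory. -/
def output : Prog :=
  asg 10 (.tab 7 (.var 3)) ;;
  asg 6 0 ;;
  while_ (.var 6) (.var 3)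
    (stLow (2 * .var 6) (.var 10 / .var 0) ;;
      stLow (2 * .var 6 + 1) (.var 10 % .var 0) ;;
      asg 10 (.tab 10 (.var 10 / .var 0)) ;;
      asg 6 (.var 6 + 1))

theorem wp_output (hW : 200 * (n + 1) ≤ W) (h0 : h.var 0 = n) {l : List (Fin n × Fin n)}
    (hl : l.length = h.var 3) (hn : h.var 3 ≤ 2 * n)
    (hf : Follows (h.tab 10) (h.tab 7 (h.var 3)) l) :
    wp W n output (fun h' t' => h'.var 3 = h.var 3 ∧
      (∀ (i : ℕ) (hi : i < l.length), h'.low (2 * i) = (l[i]'hi).1 ∧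
        h'.low (2 * i + 1) = (l[i]'hi).2) ∧ t' ≤ t + 100 + 200 * n) h t := by
  let I : Store → ℕ → Prop := fun h' t' => h'.var 0 = n ∧ h'.var 3 = h.var 3 ∧
    h'.tab 10 = h.tab 10 ∧ h'.var 6 ≤ h.var 3 ∧
    Follows (h.tab 10) (h'.var 10) (l.drop (h'.var 6)) ∧
    (∀ (i : ℕ) (hi : i < l.length), i < h'.var 6 → h'.low (2 * i) = (l[i]'hi).1 ∧
        h'.low (2 * i + 1) = (l[i]'hi).2) ∧
    t' ≤ t + 20 + 60 * h'.var 6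
  unfold output
  refine wp_seq (wp_asg (by norm_num) ?_ (wp_seq (wp_asg (by norm_num) (by simp)
    (wp_while I (fun h' => h.var 3 - h'.var 6) ?_ ?_ ?_ ?_))))
  · simp; omega
  · exact ⟨by simpa using h0, by simp, by simp, by simp, by simpa using hf, by simp, by simp⟩
  · intro h' t' _
    simp
  · rintro h' t' ⟨e0, e3, e10, hle, hfol, hdone, ht⟩ hlt
    simp [e3] at hlt
    have hil : h'.var 6 < l.length := by omega
    rw [List.drop_eq_getElem_cons hil] at hfol
    obtain ⟨hc, hfol⟩ := hfol
    have h1n := (l[h'.var 6]'hil).1.isLt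
    have h2n := (l[h'.var 6]'hil).2.isLt
    have hdiv : h'.var 10 / n = (l[h'.var 6]'hil).1 := by
      rw [hc, add_comm, Nat.add_mul_div_right _ _ (by omega), Nat.div_eq_of_lt h2n, zero_add]
    have hmod : h'.var 10 % n = (l[h'.var 6]'hil).2 := by
      rw [hc, add_comm, Nat.add_mul_mod_self_right, Nat.mod_eq_of_lt h2n]
    refine wp_seq (wp_stLow ?_ ?_ ?_ (wp_seq (wp_stLow ?_ ?_ ?_ (wp_seq (wp_asg (by norm_num) ?_
      (wp_asg (by norm_num) ?_ ⟨⟨?_, ?_, ?_, ?_, ?_, ?_, ?_⟩, ?_⟩))))))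
    · simp; omega
    · simp [e0, hdiv]; omega
    · simp; omega
    · simp; omega
    · simp [e0, hmod]; omega
    · simp; omega
    · simp [e0, hdiv]; omega
    · simp; omega
    · simpa using e0
    · simpa using e3
    · simpa using e10
    · simp; omega
    · simpa [e0, hdiv, e10] using hfol
    · intro i hi hlt'
      simp at hlt'
      rcases Nat.lt_or_ge i (h'.var 6) with h3 | h3
      · have a1 : 2 * i ≠ 2 * h'.var 6 + 1 := by omega
        have a2 : i ≠ h'.var 6 := by omega
        have a3 : 2 * i + 1 ≠ 2 * h'.var 6 := by omega
        simpa [a1, a2, a3] using hdone i hi h3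
      · obtain rfl : i = h'.var 6 := by omega
        simp [e0, hdiv, hmod]
    · simp; omega
    · simp; omega
  · rintro h' t' ⟨e0, e3, e10, hle, hfol, hdone, ht⟩ hlt
    simp [e3] at hlt
    refine ⟨e3, fun i hi => hdone i hi (by omega), ?_⟩
    simp; omega

/-! ### The complete program -/

/-- The whole algorithm, except for the final transfer of the result to the registers `0`
and `1`. -/
def matching : Prog := bucket 0 0 1 ;; bucket 1 2 3 ;; sweep ;; output

/-- The store that corresponds to the input of a trapezoid model. -/
def inputStore (τ : TrapezoidModel n) : Store where
  var := τ.input.reg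
  low := τ.input.mem
  tab _ _ := 0

theorem represents_inputStore : Represents n (inputStore τ) τ.input where
  zero := rfl
  var _ _ := rfl
  low _ _ := rfl
  tab j _ i := by
    have : ¬ (16 * i + 4 * n + j) / 4 < n := by omega
    simp [TrapezoidModel.input, inputStore, this]

theorem inputStore_low (o : ℕ) (ho : o < 4) (i : Fin n) :
    (inputStore τ).low (4 * i + o) = τ.crd o i := by
  have h1 : (4 * (i : ℕ) + o) / 4 = i := by omega
  have h2 : (4 * (i : ℕ) + o) % 4 = o := by omega
  simp only [inputStore, TrapezoidModel.input, h1, h2, i.isLt, dif_pos]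
  rfl

theorem sweepAt_one (h0 : h.var 0 = n)
    (hlow : ∀ o < 4, ∀ i : Fin n, h.low (4 * i + o) = τ.crd o i)
    (h1 : h.var 1 = 1) (h2 : h.var 2 = 0) (h3 : h.var 3 = 0)
    (hb : Buckets τ 0 (h.tab 0) (h.tab 1)) (hb' : Buckets τ 1 (h.tab 2) (h.tab 3))
    (htab : ∀ j, 4 ≤ j → ∀ i, h.tab j i = 0) : SweepAt τ 1 ∅ ∅ h where
  pos := le_refl _
  le := by omega
  var := h1
  sweep :=
    { zero := h0
      low := hlow
      thr := by
        refine ⟨htab 6 (by norm_num) 0, by simp [h3], ?_, ?_, ?_, ?_, ?_, ?_, ?_⟩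
        · intro k hk hk'; omega
        all_goals simp
      bound := fun k => by simp [htab 6 (by norm_num)]
      xs := h2 ▸ Lists.empty _ (htab 4 (by norm_num) 0)
      ys := h2 ▸ Lists.empty _ (htab 5 (by norm_num) 0) }
  mem_left i := by have := τ.one_le_x₁ i; simp; omega
  mem_right i := by have := τ.one_le_x₁ i; have := (τ.trap i).hx; simp; omega
  covered := by simp
  lefts := hb
  rights := hb'

theorem paid_le (S D : Finset (Fin n)) :
    paid τ S D ≤ 1000 * n + 4000 * τ.graph.edgeSet.ncard := by
  have key : ∀ S : Finset (Fin n), ∑ i ∈ S, (500 + 1000 * τ.deg i) ≤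
      500 * n + 2000 * τ.graph.edgeSet.ncard := by
    intro S
    calc ∑ i ∈ S, (500 + 1000 * τ.deg i) ≤ ∑ i, (500 + 1000 * τ.deg i) :=
          Finset.sum_le_sum_of_subset (Finset.subset_univ _)
      _ = 500 * n + 2000 * τ.graph.edgeSet.ncard := by
          rw [Finset.sum_add_distrib, ← Finset.mul_sum, sum_deg]
          simp
          ring
  have h1 := key S
  have h2 := key D
  unfold paid
  omega

theorem wp_matching (hW : 200 * (n + 1) ≤ W) (hW' : n * n ≤ W) :
    wp W n matching (fun h' t' => ∃ l : List (Fin n × Fin n), l.length = h'.var 3 ∧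
      (∀ (i : ℕ) (hi : i < l.length), h'.low (2 * i) = (l[i]'hi).1 ∧
        h'.low (2 * i + 1) = (l[i]'hi).2) ∧ l.length ≤ 2 * n ∧
      (l.map fun p => s(p.1, p.2)).Nodup ∧
      τ.graph.IsMaximumInducedMatching (l.map fun p => s(p.1, p.2)).toFinset ∧
      t' ≤ 4000 * (n + τ.graph.edgeSet.ncard + 1)) (inputStore τ) 0 := by
  unfold matching
  refine wp_seq (wp_mono (wp_bucket hW (τ := τ) (o := 0) (by norm_num) (by norm_num) (by norm_num)
    (by norm_num) rfl inputStore_low (fun _ => rfl)) ?_)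
  rintro h₁ t₁ ⟨b₁, fr₁, ht₁⟩
  refine wp_seq (wp_mono (wp_bucket hW (τ := τ) (o := 1) (by norm_num) (by norm_num) (by norm_num)
    (by norm_num) (fr₁.2.1 0 (by simp)) (by rw [fr₁.1]; exact inputStore_low)
    (fun _ => by rw [fr₁.2.2 2 (by simp)]; rfl)) ?_)
  rintro h₂ t₂ ⟨b₂, fr₂, ht₂⟩
  have fr : Frame [5] [0, 1, 2, 3] (inputStore τ) h₂ :=
    fr₁.trans (fr₂.trans .refl) (ts' := [0, 1, 2, 3])
  have hv : ∀ r, r ≠ 0 → r ≠ 5 → h₂.var r = 0 := by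
    intro r hr0 hr5
    rw [fr.2.1 r (by simp [hr5])]
    simp [inputStore, TrapezoidModel.input, hr0]
  have hs : SweepAt τ 1 ∅ ∅ (h₂.set 1 1) := by
    refine sweepAt_one ?_ ?_ (by simp) ?_ ?_ ?_ (by simpa using b₂) ?_
    · simpa [fr.2.1] using represents_inputStore.zero
    · simpa [fr.1] using inputStore_low
    · simp [hv]
    · simp [hv]
    · simpa [fr₂.2.2] using b₁
    · intro j hj i
      rw [Store.set_tab, fr.2.2 j (by simp; omega)]
      rfl
  refine wp_seq (wp_mono (wp_sweep hW hW' hs) ?_)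
  rintro h₃ t₃ ⟨S, D, hs, ht₃⟩
  have hD : ∀ i, i ∈ D := fun i => by
    rw [hs.mem_right]
    have := τ.x₂_le i
    omega
  have hthr := hs.sweep.thr
  obtain ⟨l, hl, hfol, hnd, hmax⟩ := hthr.exists_maximum
    (fun w v => hs.covered w (hD w) v (hD v))
  refine wp_mono (wp_output hW hs.sweep.zero hl hthr.length_le hfol) ?_
  rintro h₄ t₄ ⟨e3, hout, ht₄⟩
  have hpaid := paid_le (τ := τ) S D
  exact ⟨l, hl.trans e3.symm, hout, hl.le.trans hthr.length_le, hnd, hmax, by omega⟩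

end WordRAM

theorem mainTheorem4 :
    ∃ (P : WordRAM.Prog) (C : ℕ), ∀ (n : ℕ) (τ : TrapezoidModel n),
      ∃ (s : WordRAM.State) (t : ℕ) (M : Finset (Sym2 (Fin n))),
        WordRAM.Exec (C * (n + 1) ^ C) P τ.input s t ∧
        t ≤ C * (n + τ.graph.edgeSet.ncard + 1) ∧
        s.Outputs M ∧
        τ.graph.IsMaximumInducedMatching M := by
  refine ⟨WordRAM.Prog.seq WordRAM.matching (.seq (.copy 0 3) (.const 1 0)), 5000, fun n τ => ?_⟩
  have hpow : ∀ k, 2 ≤ k → (n + 1) * (n + 1) ≤ (n + 1) ^ k := fun k hk => by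
    rw [← sq]
    exact Nat.pow_le_pow_right n.succ_pos hk
  replace hpow := hpow 5000 (by norm_num)
  generalize (n + 1) ^ 5000 = w at hpow ⊢
  have hW : 200 * (n + 1) ≤ 5000 * w := by nlinarith
  have hW' : n * n ≤ 5000 * w := by nlinarith
  obtain ⟨s, h, t, hx, hr, l, hlen, hout, hle, hnd, hmax, ht⟩ :=
    WordRAM.wp_matching hW hW' (τ := τ) _ WordRAM.represents_inputStore
  refine ⟨(s.setReg 0 (s.reg 3)).setReg 1 0, t + (1 + 1), _, .seq hx (.seq (.copy _ _ _)
    (.const _ _ _ (Nat.zero_le _))), by omega, ⟨l, ?_, ?_, hnd, fun e => List.mem_toFinset⟩, hmax⟩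
  · simp [WordRAM.State.setReg, hlen, hr.var 3]
  · intro i hi
    have h1 := hout i hi
    simp only [WordRAM.State.setReg, Function.update_self, zero_add]
    rw [hr.low _ (by omega), hr.low _ (by omega)]
    exact h1
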